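/- A 3-Lie algebra is a real vector space $\mathfrak g$ with a linear map $\pi:\wedge^3\mathfrak g\to\mathfrak g$ such that $$\pi(x_1,x_2,\pi(x_3,x_4,x_5))=\pi(\pi(x_1,x_2,x_3),x_4,x_5)+\pi(x_3,\pi(x_1,x_2,x_4),x_5)+\pi(x_3,x_4,\pi(x_1,x_2,x_5)).$$ Let $(\mathfrak g,\pi)$ be a finite-dimensional 3-Lie algebra and let $\mathfrak h\subset\mathfrak g$ be a $k$-dimensional 3-Lie subalgebra, i.e. a $k$-dimensional linear subspace closed under $\pi$. Let $\rho:\wedge^2\mathfrak h\to\mathrm{End}(\mathfrak g/\mathfrak h)$, $\rho(u,v)\overline{x}=\overline{\pi(u,v,x)}$, be the induced representation of $\mathfrak h$ on $\mathfrak g/\mathfrak h$. For linear $\theta:\mathfrak h\to\mathfrak g/\mathfrak h$ put $$(\partial\theta)(x,y,z)=-\theta(\pi(x,y,z))+\rho(x,y)\theta(z)+\rho(y,z)\theta(x)+\rho(z,x)\theta(y),$$ and for $\theta:\wedge^3\mathfrak h\to\mathfrak g/\mathfrak h$ put $$\begin{aligned}(\partial\theta)(x_1\wedge y_1,x_2\wedge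 y_2,x_3)={}&-\theta(\pi(x_1,y_1,x_2),y_2,x_3)-\theta(x_2,\pi(x_1,y_1,y_2),x_3)-\theta(x_2,y_2,\pi(x_1,y_1,x_3))\\&+\theta(x_1,y_1,\pi(x_2,y_2,x_3))+\rho(x_1,y_1)\theta(x_2,y_2,x_3)-\rho(x_2,y_2)\theta(x_1,y_1,x_3)\\&-\rho(y_2,x_3)\theta(x_1,y_1,x_2)-\rho(x_3,x_2)\theta(x_1,y_1,y_2).\end{aligned}$$ Let $$Z^1(\mathfrak h,\mathfrak g/\mathfrak h)=\ker\big(\partial|_{\mathrm{Hom}(\mathfrak h,\mathfrak g/\mathfrak h)}\big),\qquad H^2(\mathfrak h,\mathfrak g/\mathfrak h)=\ker\big(\partial|_{\mathrm{Hom}(\wedge^3\mathfrak h,\mathfrak g/\mathfrak h)}\big)\big/\partial\big(\mathrm{Hom}(\mathfrak h,\mathfrak g/\mathfrak h)\big).$$ **Theorem.** Suppose that $H^2(\mathfrak h,\mathfrak g/\mathfrak h)=0$. 1. In a neighbourhood of $\mathfrak h$ in the Grassmann manifold $\mathrm{Gr}_k(\mathfrak g)$ of $k$-dimensional linear subspaces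 of $\mathfrak g$, the set of $k$-dimensional 3-Lie subalgebras of $\mathfrak g$ is a smooth embedded submanifold of dimension $\dim Z^1(\mathfrak h,\mathfrak g/\mathfrak h)$. 2. Every $\alpha\in Z^1(\mathfrak h,\mathfrak g/\mathfrak h)$ gives rise to a deformation of $\mathfrak h$: there is a smooth curve $t\mapsto\mathfrak h_t$, $t\in\mathbb R$, in $\mathrm{Gr}_k(\mathfrak g)$ with $\mathfrak h_0=\mathfrak h$, such that every $\mathfrak h_t$ is a 3-Lie subalgebra of $\mathfrak g$ and $\dot{\mathfrak h}_0=\alpha$. The last equation means that there is a smooth curve $A(t)$ in $\mathrm{GL}(\mathfrak g)$ with $A(0)=\mathrm{id}$ and $A(t)\mathfrak h=\mathfrak h_t$ for all $t$ such that $\alpha(u)=\frac{d}{dt}\big|_{t=0}A(t)u \bmod \mathfrak h$ for all $u\in\mathfrak h$. -/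

import Mathlib

open scoped Manifold ContDiff
open Module

namespace ThreeLie

/-! ### Alternating maps in two and three variables -/

section Alternating

variable {L V : Type*} [AddCommGroup L] [Module ℝ L] [AddCommGroup V] [Module ℝ V]

theorem eq_zero_of_eq_neg {v : V} (h : v = -v) : v = 0 := by
  have h2 : (2 : ℝ) • v = 0 := by
    rw [two_smul]
    nth_rewrite 2 [h]
    exact add_neg_cancel v
  exact (smul_eq_zero.mp h2).resolve_left two_ne_zero

theorem alt2_add (θ : L [⋀^Fin 2]→ₗ[ℝ] V) (x x' y : L) :
    θ ![x + x', y] = θ ![x, y] + θ ![x', y] :=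
  θ.map_vecCons_add _ _ _

theorem alt2_smul (θ : L [⋀^Fin 2]→ₗ[ℝ] V) (c : ℝ) (x y : L) :
    θ ![c • x, y] = c • θ ![x, y] :=
  θ.map_vecCons_smul _ _ _

theorem alt2_swap (θ : L [⋀^Fin 2]→ₗ[ℝ] V) (x y : L) : θ ![y, x] = - θ ![x, y] := by
  have h := θ.map_swap ![x, y] (i := 0) (j := 1) (by decide)
  rw [← h]
  congr 1
  ext i; fin_cases i <;> simp

theorem alt3_add (θ : L [⋀^Fin 3]→ₗ[ℝ] V) (x x' y z : L) :
    θ ![x + x', y, z] = θ ![x, y, z] + θ ![x', y, z] :=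
  θ.map_vecCons_add _ _ _

theorem alt3_smul (θ : L [⋀^Fin 3]→ₗ[ℝ] V) (c : ℝ) (x y z : L) :
    θ ![c • x, y, z] = c • θ ![x, y, z] :=
  θ.map_vecCons_smul _ _ _

theorem alt3_self (θ : L [⋀^Fin 3]→ₗ[ℝ] V) (x z : L) : θ ![x, x, z] = 0 :=
  θ.map_eq_zero_of_eq _ (i := 0) (j := 1) (by simp) (by decide)

theorem alt3_swap (θ : L [⋀^Fin 3]→ₗ[ℝ] V) (x y z : L) :
    θ ![y, x, z] = - θ ![x, y, z] := by
  have h := θ.map_swap ![x, y, z] (i := 0) (j := 1) (by decide)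
  rw [← h]
  congr 1
  ext i; fin_cases i <;> simp [Equiv.swap_apply_def]

theorem alt3_swap' (θ : L [⋀^Fin 3]→ₗ[ℝ] V) (x y z : L) :
    θ ![x, z, y] = - θ ![x, y, z] := by
  have h := θ.map_swap ![x, y, z] (i := 1) (j := 2) (by decide)
  rw [← h]
  congr 1
  ext i; fin_cases i <;> simp [Equiv.swap_apply_def]

theorem alt3_cyc (θ : L [⋀^Fin 3]→ₗ[ℝ] V) (x y z : L) : θ ![x, y, z] = θ ![y, z, x] := by
  rw [alt3_swap' θ y x z, alt3_swap θ x y z, neg_neg]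

theorem alt3_add3 (θ : L [⋀^Fin 3]→ₗ[ℝ] V) (x y z z' : L) :
    θ ![x, y, z + z'] = θ ![x, y, z] + θ ![x, y, z'] := by
  simp only [← alt3_cyc θ _ x y, alt3_add]

theorem alt3_smul3 (θ : L [⋀^Fin 3]→ₗ[ℝ] V) (c : ℝ) (x y z : L) :
    θ ![x, y, c • z] = c • θ ![x, y, z] := by
  simp only [← alt3_cyc θ _ x y, alt3_smul]

theorem alt3_add2 (θ : L [⋀^Fin 3]→ₗ[ℝ] V) (x y y' z : L) :
    θ ![x, y + y', z] = θ ![x, y, z] + θ ![x, y', z] := by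
  simp only [alt3_cyc θ x, alt3_add]

theorem alt3_smul2 (θ : L [⋀^Fin 3]→ₗ[ℝ] V) (c : ℝ) (x y z : L) :
    θ ![x, c • y, z] = c • θ ![x, y, z] := by
  simp only [alt3_cyc θ x, alt3_smul]

/-- A skew-symmetric bilinear map, as an alternating map. -/
def mkAlt2 (f : L → L → V) (hadd : ∀ x x' y, f (x + x') y = f x y + f x' y)
    (hsmul : ∀ (c : ℝ) x y, f (c • x) y = c • f x y) (hskew : ∀ x y, f x y = - f y x) :
    L [⋀^Fin 2]→ₗ[ℝ] V where
  toFun v := f (v 0) (v 1)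
  map_update_add' := by
    intro inst v i x y
    obtain rfl | rfl : i = 0 ∨ i = 1 := by omega
    · simp [hadd]
    · have h := hskew (v 0)
      simp [h, hadd, add_comm]
  map_update_smul' := by
    intro inst v i c x
    obtain rfl | rfl : i = 0 ∨ i = 1 := by omega
    · simp [hsmul]
    · have h := hskew (v 0)
      simp [h, hsmul]
  map_eq_zero_of_eq' := by
    intro v i j hij hne
    have h0 : v 0 = v 1 := by
      obtain rfl | rfl : i = 0 ∨ i = 1 := by omega
      · obtain rfl : j = 1 := by omega
        exact hij
      · obtain rfl : j = 0 := by omega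
        exact hij.symm
    rw [h0]
    exact eq_zero_of_eq_neg (hskew _ _)

@[simp] theorem mkAlt2_apply (f : L → L → V) (h1 h2 h3) (x y : L) :
    mkAlt2 f h1 h2 h3 ![x, y] = f x y := rfl

/-- A trilinear alternating map, given by its values. -/
def mkAlt3 (f : L → L → L → V) (hadd : ∀ x x' y z, f (x + x') y z = f x y z + f x' y z)
    (hsmul : ∀ (c : ℝ) x y z, f (c • x) y z = c • f x y z)
    (hcyc : ∀ x y z, f x y z = f y z x) (hself : ∀ x z, f x x z = 0) :
    L [⋀^Fin 3]→ₗ[ℝ] V where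
  toFun v := f (v 0) (v 1) (v 2)
  map_update_add' := by
    have h10 : (1 : Fin 3) ≠ 0 := by decide
    have h20 : (2 : Fin 3) ≠ 0 := by decide
    have h01 : (0 : Fin 3) ≠ 1 := by decide
    have h21 : (2 : Fin 3) ≠ 1 := by decide
    have h02 : (0 : Fin 3) ≠ 2 := by decide
    have h12 : (1 : Fin 3) ≠ 2 := by decide
    intro inst v i x y
    obtain rfl | rfl | rfl : i = 0 ∨ i = 1 ∨ i = 2 := by omega
    · simp only [Function.update_self, Function.update_of_ne h10, Function.update_of_ne h20, hadd]
    · have h := hcyc (v 0)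
      simp only [Function.update_self, Function.update_of_ne h01, Function.update_of_ne h21, h, hadd]
    · have h := fun a b => (hcyc a (v 0) b).symm
      simp only [Function.update_self, Function.update_of_ne h02, Function.update_of_ne h12, h, hadd]
  map_update_smul' := by
    have h10 : (1 : Fin 3) ≠ 0 := by decide
    have h20 : (2 : Fin 3) ≠ 0 := by decide
    have h01 : (0 : Fin 3) ≠ 1 := by decide
    have h21 : (2 : Fin 3) ≠ 1 := by decide
    have h02 : (0 : Fin 3) ≠ 2 := by decide
    have h12 : (1 : Fin 3) ≠ 2 := by decide
    intro inst v i c x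
    obtain rfl | rfl | rfl : i = 0 ∨ i = 1 ∨ i = 2 := by omega
    · simp only [Function.update_self, Function.update_of_ne h10, Function.update_of_ne h20, hsmul]
    · have h := hcyc (v 0)
      simp only [Function.update_self, Function.update_of_ne h01, Function.update_of_ne h21, h, hsmul]
    · have h := fun a b => (hcyc a (v 0) b).symm
      simp only [Function.update_self, Function.update_of_ne h02, Function.update_of_ne h12, h, hsmul]
  map_eq_zero_of_eq' := by
    intro v i j hij hne
    have h2 : ∀ x z, f x z z = 0 := fun x z => by rw [hcyc, hself]
    have h3 : ∀ x z, f x z x = 0 := fun x z => by rw [← hcyc, hself]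
    rcases (by omega : i = 0 ∨ i = 1 ∨ i = 2) with rfl | rfl | rfl <;>
    rcases (by omega : j = 0 ∨ j = 1 ∨ j = 2) with rfl | rfl | rfl <;>
    first
    | exact absurd rfl hne
    | simp [hij, hself, h2, h3]

@[simp] theorem mkAlt3_apply (f : L → L → L → V) (h1 h2 h3 h4) (x y z : L) :
    mkAlt3 f h1 h2 h3 h4 ![x, y, z] = f x y z := rfl

theorem alt2_ext {θ η : L [⋀^Fin 2]→ₗ[ℝ] V} (h : ∀ x y, θ ![x, y] = η ![x, y]) : θ = η := by
  ext v
  have hv : v = ![v 0, v 1] := by ext i; fin_cases i <;> rfl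
  rw [hv]; exact h _ _

theorem alt3_ext {θ η : L [⋀^Fin 3]→ₗ[ℝ] V} (h : ∀ x y z, θ ![x, y, z] = η ![x, y, z]) :
    θ = η := by
  ext v
  have hv : v = ![v 0, v 1, v 2] := by ext i; fin_cases i <;> rfl
  rw [hv]; exact h _ _ _

end Alternating

/-! ### 3-Lie algebras, subalgebras, representations -/

/-- A 3-Lie algebra structure on the real vector space `L`. -/
structure ThreeLieAlgebra (L : Type*) [AddCommGroup L] [Module ℝ L] where
  /-- the bracket `⋀³ L → L` -/
  bracket : L [⋀^Fin 3]→ₗ[ℝ] L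
  fundamental : ∀ x₁ x₂ x₃ x₄ x₅ : L,
    bracket ![x₁, x₂, bracket ![x₃, x₄, x₅]] =
      bracket ![bracket ![x₁, x₂, x₃], x₄, x₅] + bracket ![x₃, bracket ![x₁, x₂, x₄], x₅]
        + bracket ![x₃, x₄, bracket ![x₁, x₂, x₅]]

/-- A representation of a 3-Lie algebra `(L, π)` on a vector space `V`. -/
structure Representation {L : Type*} [AddCommGroup L] [Module ℝ L] (π : ThreeLieAlgebra L)
    (V : Type*) [AddCommGroup V] [Module ℝ V] where
  /-- the linear map `⋀² L → Hom(V, V)` -/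
  ρ : L [⋀^Fin 2]→ₗ[ℝ] (V →ₗ[ℝ] V)
  comm : ∀ x₁ x₂ x₃ x₄ : L,
    ρ ![x₁, x₂] ∘ₗ ρ ![x₃, x₄] =
      ρ ![π.bracket ![x₁, x₂, x₃], x₄] + ρ ![x₃, π.bracket ![x₁, x₂, x₄]]
        + ρ ![x₃, x₄] ∘ₗ ρ ![x₁, x₂]
  deriv : ∀ x₁ x₂ x₃ x₄ : L,
    ρ ![x₁, π.bracket ![x₂, x₃, x₄]] =
      ρ ![x₃, x₄] ∘ₗ ρ ![x₁, x₂] - ρ ![x₂, x₄] ∘ₗ ρ ![x₁, x₃] + ρ ![x₂, x₃] ∘ₗ ρ ![x₁, x₄]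

section Algebra

variable {L : Type*} [AddCommGroup L] [Module ℝ L]

/-- The linear subspace `U` is a 3-Lie subalgebra of `(L, π)`. -/
def ThreeLieAlgebra.IsSubalgebra (π : ThreeLieAlgebra L) (U : Submodule ℝ L) : Prop :=
  ∀ x ∈ U, ∀ y ∈ U, ∀ z ∈ U, π.bracket ![x, y, z] ∈ U

/-- The 3-Lie algebra structure of a 3-Lie subalgebra. -/
def ThreeLieAlgebra.restrict (π : ThreeLieAlgebra L) (H : Submodule ℝ L) (hH : π.IsSubalgebra H) :
    ThreeLieAlgebra H where
  bracket := mkAlt3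
    (fun x y z => ⟨π.bracket ![(x : L), (y : L), (z : L)], hH _ x.2 _ y.2 _ z.2⟩)
    (fun _ _ _ _ => Subtype.ext (alt3_add _ _ _ _ _))
    (fun _ _ _ _ => Subtype.ext (alt3_smul _ _ _ _ _))
    (fun _ _ _ => Subtype.ext (alt3_cyc _ _ _ _))
    (fun _ _ => Subtype.ext (alt3_self _ _ _))
  fundamental x₁ x₂ x₃ x₄ x₅ := Subtype.ext (π.fundamental x₁ x₂ x₃ x₄ x₅)

@[simp] theorem ThreeLieAlgebra.coe_restrict_bracket (π : ThreeLieAlgebra L) (H : Submodule ℝ L)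
    (hH : π.IsSubalgebra H) (x y z : H) :
    (((π.restrict H hH).bracket ![x, y, z] : H) : L) = π.bracket ![(x : L), (y : L), (z : L)] :=
  rfl

/-- `ad_{x ∧ y} = π(x, y, ·)`. -/
def ThreeLieAlgebra.ad (π : ThreeLieAlgebra L) (x y : L) : L →ₗ[ℝ] L where
  toFun z := π.bracket ![x, y, z]
  map_add' := alt3_add3 _ _ _
  map_smul' c _ := alt3_smul3 _ c _ _ _

@[simp] theorem ThreeLieAlgebra.ad_apply (π : ThreeLieAlgebra L) (x y z : L) :
    π.ad x y z = π.bracket ![x, y, z] := rfl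

/-- For `u, v` in a 3-Lie subalgebra `H`, the map `L ⧸ H → L ⧸ H` induced by `ad_{u ∧ v}`. -/
def ThreeLieAlgebra.quotientAd (π : ThreeLieAlgebra L) (H : Submodule ℝ L) (hH : π.IsSubalgebra H)
    (u v : H) : (L ⧸ H) →ₗ[ℝ] (L ⧸ H) :=
  H.mapQ H (π.ad u v) (fun z hz => hH _ u.2 _ v.2 z hz)

@[simp] theorem ThreeLieAlgebra.quotientAd_mk (π : ThreeLieAlgebra L) (H : Submodule ℝ L)
    (hH : π.IsSubalgebra H) (u v : H) (x : L) :
    π.quotientAd H hH u v (Submodule.Quotient.mk x) =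
      Submodule.Quotient.mk (π.bracket ![(u : L), (v : L), x]) := rfl

/-- The representation of a 3-Lie subalgebra `H` on `L ⧸ H` induced by the adjoint action. -/
def ThreeLieAlgebra.quotientRep (π : ThreeLieAlgebra L) (H : Submodule ℝ L) (hH : π.IsSubalgebra H) :
    Representation (π.restrict H hH) (L ⧸ H) where
  ρ := mkAlt2 (π.quotientAd H hH)
    (fun x x' y => by
      ext z
      simp [alt3_add])
    (fun c x y => by
      ext z
      simp [alt3_smul])
    (fun x y => by
      ext z
      simp [alt3_swap π.bracket (y : L) (x : L)])
  comm x₁ x₂ x₃ x₄ := by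
    ext z
    simp [π.fundamental (x₁ : L) x₂ x₃ x₄ z]
  deriv x₁ x₂ x₃ x₄ := by
    ext z
    have h : π.bracket ![(x₁ : L), π.bracket ![(x₂ : L), x₃, x₄], z] =
        π.bracket ![(x₃ : L), x₄, π.bracket ![(x₁ : L), x₂, z]]
        - π.bracket ![(x₂ : L), x₄, π.bracket ![(x₁ : L), x₃, z]]
        + π.bracket ![(x₂ : L), x₃, π.bracket ![(x₁ : L), x₄, z]] := by
      rw [alt3_swap' π.bracket (x₁ : L) z, π.fundamental]
      rw [alt3_swap' π.bracket (x₁ : L) x₂ z, alt3_swap' π.bracket (x₁ : L) x₃ z,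
        alt3_swap' π.bracket (x₁ : L) x₄ z]
      rw [alt3_cyc π.bracket _ (x₃ : L) x₄, alt3_swap' π.bracket (x₂ : L) x₄ (- _)]
      simp only [← neg_one_smul ℝ (π.bracket _), alt3_smul3]
      module
    simp [h]

end Algebra

/-! ### The cochain complex in degrees one, two and three

`C¹ = Hom(L, V)`, `C² = Hom(⋀³ L, V)`, `C³ = Hom(⋀² L ⊗ ⋀³ L, V)`. -/

section Cohomology

variable {L : Type*} [AddCommGroup L] [Module ℝ L] {π : ThreeLieAlgebra L}
  {V : Type*} [AddCommGroup V] [Module ℝ V]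

/-- The coboundary of a linear map `θ`. -/
def Representation.d₁Fun (R : Representation π V) (θ : L →ₗ[ℝ] V) : L [⋀^Fin 3]→ₗ[ℝ] V :=
  mkAlt3
    (fun x y z => - θ (π.bracket ![x, y, z]) + R.ρ ![x, y] (θ z)
      + (R.ρ ![y, z] (θ x) + R.ρ ![z, x] (θ y)))
    (fun x x' y z => by
      simp only [alt3_add, alt2_add, map_add, alt2_swap R.ρ _ z, LinearMap.add_apply,
        LinearMap.neg_apply]
      abel)
    (fun c x y z => by
      simp only [alt3_smul, alt2_smul, map_smul, alt2_swap R.ρ _ z, LinearMap.smul_apply,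
        LinearMap.neg_apply]
      module)
    (fun x y z => by
      rw [alt3_cyc π.bracket x y z]
      abel)
    (fun x z => by
      have h : R.ρ ![x, x] = 0 := eq_zero_of_eq_neg (alt2_swap R.ρ x x)
      rw [alt3_self, h, alt2_swap R.ρ x z]
      simp)

/-- The coboundary operator `C¹ → C²`. -/
def Representation.d₁ (R : Representation π V) :
    (L →ₗ[ℝ] V) →ₗ[ℝ] (L [⋀^Fin 3]→ₗ[ℝ] V) where
  toFun := R.d₁Fun
  map_add' θ η := alt3_ext fun x y z => by
    simp only [d₁Fun, mkAlt3_apply, AlternatingMap.add_apply, LinearMap.add_apply, map_add]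
    abel
  map_smul' c θ := alt3_ext fun x y z => by
    simp only [d₁Fun, mkAlt3_apply, AlternatingMap.smul_apply, LinearMap.smul_apply, map_smul,
      RingHom.id_apply]
    module

theorem Representation.d₁_apply (R : Representation π V) (θ : L →ₗ[ℝ] V) (x y z : L) :
    R.d₁ θ ![x, y, z] = - θ (π.bracket ![x, y, z]) + R.ρ ![x, y] (θ z)
      + (R.ρ ![y, z] (θ x) + R.ρ ![z, x] (θ y)) := rfl

/-- The values of the coboundary of `θ : ⋀³ L → V` on `x₁ ∧ y₁ ⊗ x₂ ∧ y₂ ∧ x₃`. -/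
def Representation.d₂Val (R : Representation π V) (θ : L [⋀^Fin 3]→ₗ[ℝ] V)
    (x₁ y₁ x₂ y₂ x₃ : L) : V :=
  - (θ ![π.bracket ![x₁, y₁, x₂], y₂, x₃] + θ ![x₂, π.bracket ![x₁, y₁, y₂], x₃])
    - θ ![x₂, y₂, π.bracket ![x₁, y₁, x₃]] + θ ![x₁, y₁, π.bracket ![x₂, y₂, x₃]]
    + R.ρ ![x₁, y₁] (θ ![x₂, y₂, x₃]) - R.ρ ![x₂, y₂] (θ ![x₁, y₁, x₃])
    - (R.ρ ![y₂, x₃] (θ ![x₁, y₁, x₂]) + R.ρ ![x₃, x₂] (θ ![x₁, y₁, y₂]))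

/-- The coboundary of `θ : ⋀³ L → V`. -/
def Representation.d₂Fun (R : Representation π V) (θ : L [⋀^Fin 3]→ₗ[ℝ] V) :
    L [⋀^Fin 2]→ₗ[ℝ] (L [⋀^Fin 3]→ₗ[ℝ] V) :=
  mkAlt2
    (fun x₁ y₁ => mkAlt3 (R.d₂Val θ x₁ y₁)
      (fun x x' y z => by
        simp only [d₂Val, alt3_add, alt3_add3, alt2_add, map_add, alt2_swap R.ρ _ z,
          LinearMap.add_apply, LinearMap.neg_apply]
        abel)
      (fun c x y z => by
        simp only [d₂Val, alt3_smul, alt3_smul3, alt2_smul, map_smul, alt2_swap R.ρ _ z,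
          LinearMap.smul_apply, LinearMap.neg_apply]
        module)
      (fun x y z => by
        simp only [d₂Val]
        rw [alt3_cyc π.bracket x y z, alt3_cyc θ x y z, alt3_cyc θ (π.bracket _) y z,
          alt3_cyc θ x (π.bracket _) z, alt3_cyc θ x y (π.bracket _)]
        abel)
      (fun x z => by
        have h : R.ρ ![x, x] = 0 := eq_zero_of_eq_neg (alt2_swap R.ρ x x)
        simp only [d₂Val]
        rw [alt3_self, alt3_self, alt3_self, h, alt2_swap R.ρ x z,
          alt3_swap θ x (π.bracket _) z]
        have h0 : θ ![x₁, y₁, 0] = 0 := θ.map_coord_zero 2 rfl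
        rw [h0]
        simp))
    (fun x x' y => alt3_ext fun a b c => by
      simp only [mkAlt3_apply, AlternatingMap.add_apply, d₂Val, alt3_add, alt2_add, map_add,
        alt3_add3, LinearMap.add_apply, alt3_add2]
      abel)
    (fun r x y => alt3_ext fun a b c => by
      simp only [mkAlt3_apply, AlternatingMap.smul_apply, d₂Val, alt3_smul, alt2_smul, map_smul,
        alt3_smul3, alt3_smul2, LinearMap.smul_apply]
      module)
    (fun x y => alt3_ext fun a b c => by
      simp only [mkAlt3_apply, AlternatingMap.neg_apply, d₂Val, alt3_swap π.bracket y x,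
        alt3_swap θ y x, alt2_swap R.ρ y x, ← neg_one_smul ℝ (π.bracket _), alt3_smul,
        alt3_smul3, alt3_smul2, map_neg, LinearMap.neg_apply]
      module)

/-- The coboundary operator `C² → C³`. -/
def Representation.d₂ (R : Representation π V) :
    (L [⋀^Fin 3]→ₗ[ℝ] V) →ₗ[ℝ] (L [⋀^Fin 2]→ₗ[ℝ] (L [⋀^Fin 3]→ₗ[ℝ] V)) where
  toFun := R.d₂Fun
  map_add' θ η := alt2_ext fun x₁ y₁ => alt3_ext fun x y z => by
    simp only [d₂Fun, mkAlt2_apply, mkAlt3_apply, AlternatingMap.add_apply, d₂Val, map_add]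
    abel
  map_smul' c θ := alt2_ext fun x₁ y₁ => alt3_ext fun x y z => by
    simp only [d₂Fun, mkAlt2_apply, mkAlt3_apply, AlternatingMap.smul_apply, d₂Val, map_smul,
      RingHom.id_apply]
    module

theorem Representation.d₂_apply (R : Representation π V) (θ : L [⋀^Fin 3]→ₗ[ℝ] V)
    (x₁ y₁ x₂ y₂ x₃ : L) :
    R.d₂ θ ![x₁, y₁] ![x₂, y₂, x₃] = R.d₂Val θ x₁ y₁ x₂ y₂ x₃ := rfl

theorem Representation.d₂_d₁ (R : Representation π V) (θ : L →ₗ[ℝ] V) : R.d₂ (R.d₁ θ) = 0 := by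
  refine alt2_ext fun a b => alt3_ext fun x y z => ?_
  rw [d₂_apply]
  simp only [d₂Val, d₁_apply, AlternatingMap.zero_apply, map_add, map_neg]
  have hF := congrArg θ (π.fundamental a b x y z)
  have hc := fun u v w => LinearMap.congr_fun (R.comm a b u v) (θ w)
  have hd := fun u w => LinearMap.congr_fun (R.deriv u x y z) (θ w)
  simp only [map_add, LinearMap.add_apply, LinearMap.sub_apply, LinearMap.comp_apply] at hF hc hd
  have hda := hd a b
  have hdb := hd b a
  rw [alt2_swap R.ρ z x] at hda hdb
  rw [alt2_swap R.ρ a, alt2_swap R.ρ a z, alt2_swap R.ρ a x, alt2_swap R.ρ a y]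
  simp only [LinearMap.neg_apply, map_neg] at hda hdb ⊢
  linear_combination (norm := module) hc x y z + hc y z x + hc z x y - hF + hdb - hda

/-- The 1-cocycles `Z¹(L, V)`. -/
def Representation.Z₁ (R : Representation π V) : Submodule ℝ (L →ₗ[ℝ] V) :=
  LinearMap.ker R.d₁

/-- The 2-cocycles `Z²(L, V)`. -/
def Representation.Z₂ (R : Representation π V) : Submodule ℝ (L [⋀^Fin 3]→ₗ[ℝ] V) :=
  LinearMap.ker R.d₂

/-- The 2-coboundaries `B²(L, V)`. -/
def Representation.B₂ (R : Representation π V) : Submodule ℝ (L [⋀^Fin 3]→ₗ[ℝ] V) :=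
  LinearMap.range R.d₁

theorem Representation.B₂_le_Z₂ (R : Representation π V) : R.B₂ ≤ R.Z₂ := by
  rintro _ ⟨θ, rfl⟩
  exact R.d₂_d₁ θ

/-- The second cohomology group `H²(L, V) = Z²(L, V) / B²(L, V)`. -/
abbrev Representation.H₂ (R : Representation π V) : Type _ :=
  R.Z₂ ⧸ R.B₂.submoduleOf R.Z₂

end Cohomology

/-! ### The Grassmannian as a smooth manifold -/

section Grassmannian

/-- The set of `k`-dimensional linear subspaces of `L`. -/
def Gr (k : ℕ) (L : Type*) [AddCommGroup L] [Module ℝ L] : Type _ :=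
  {U : Submodule ℝ L // finrank ℝ U = k}

variable (k m : ℕ) {L : Type*} [AddCommGroup L] [Module ℝ L]

/-- The space `Hom(ℝᵏ, ℝᵐ)`. -/
abbrev Hom (k m : ℕ) : Type := (Fin k → ℝ) →L[ℝ] (Fin m → ℝ)

variable {k m}

/-- The subspace of `L` which is the graph of `f` in the linear coordinates `e`. -/
def graphIn (e : L ≃ₗ[ℝ] (Fin k → ℝ) × (Fin m → ℝ)) (f : Hom k m) : Submodule ℝ L :=
  (f : (Fin k → ℝ) →ₗ[ℝ] (Fin m → ℝ)).graph.comap (e : L →ₗ[ℝ] (Fin k → ℝ) × (Fin m → ℝ))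

theorem mem_graphIn (e : L ≃ₗ[ℝ] (Fin k → ℝ) × (Fin m → ℝ)) (f : Hom k m) (x : L) :
    x ∈ graphIn e f ↔ (e x).2 = f (e x).1 := by
  simp [graphIn, LinearMap.mem_graph_iff]

theorem symm_mem_graphIn (e : L ≃ₗ[ℝ] (Fin k → ℝ) × (Fin m → ℝ)) (f : Hom k m)
    (v : Fin k → ℝ) : e.symm (v, f v) ∈ graphIn e f := by
  simp [mem_graphIn]

theorem graphIn_injective (e : L ≃ₗ[ℝ] (Fin k → ℝ) × (Fin m → ℝ)) :
    Function.Injective (graphIn e) := by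
  intro f g h
  ext1 v
  have := symm_mem_graphIn e f v
  rw [h, mem_graphIn] at this
  simpa using this

/-- A graph over `ℝᵏ` is isomorphic to `ℝᵏ`. -/
def graphInEquiv (e : L ≃ₗ[ℝ] (Fin k → ℝ) × (Fin m → ℝ)) (f : Hom k m) :
    graphIn e f ≃ₗ[ℝ] (Fin k → ℝ) where
  toFun x := (e x).1
  map_add' x y := by simp
  map_smul' c x := by simp
  invFun v := ⟨e.symm (v, f v), symm_mem_graphIn e f v⟩
  left_inv x := by
    have h := (mem_graphIn e f x).1 x.2
    ext
    simp [← h]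
  right_inv v := by simp

theorem finrank_graphIn (e : L ≃ₗ[ℝ] (Fin k → ℝ) × (Fin m → ℝ)) (f : Hom k m) :
    finrank ℝ (graphIn e f) = k := by
  rw [(graphInEquiv e f).finrank_eq]
  simp

open Classical in
/-- The graph chart given by linear coordinates `e : L ≃ ℝᵏ × ℝᵐ`: it sends a subspace which
is the graph of a linear map `f : ℝᵏ → ℝᵐ` to `f`. -/
noncomputable def graphChart (e : L ≃ₗ[ℝ] (Fin k → ℝ) × (Fin m → ℝ)) :
    PartialEquiv (Gr k L) (Hom k m) where
  toFun U := if h : ∃ f, graphIn e f = U.1 then h.choose else 0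
  invFun f := ⟨graphIn e f, finrank_graphIn e f⟩
  source := {U | ∃ f, graphIn e f = U.1}
  target := Set.univ
  map_source' _ _ := Set.mem_univ _
  map_target' f _ := ⟨f, rfl⟩
  left_inv' U hU := by
    have hU' : ∃ f, graphIn e f = U.1 := hU
    rw [dif_pos hU']
    exact Subtype.ext hU'.choose_spec
  right_inv' f _ := by
    have hf : ∃ g, graphIn e g = graphIn e f := ⟨f, rfl⟩
    rw [dif_pos hf]
    exact graphIn_injective e hf.choose_spec

theorem graphChart_eq (e : L ≃ₗ[ℝ] (Fin k → ℝ) × (Fin m → ℝ)) {U : Gr k L} {f : Hom k m}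
    (h : graphIn e f = U.1) : graphChart e U = f := by
  have : U = (graphChart e).symm f := Subtype.ext h.symm
  rw [this]
  exact (graphChart e).right_inv (Set.mem_univ _)

section Transition

variable (e e' : L ≃ₗ[ℝ] (Fin k → ℝ) × (Fin m → ℝ))

/-- The linear change of coordinates from `e` to `e'`. -/
noncomputable def change :
    ((Fin k → ℝ) × (Fin m → ℝ)) →L[ℝ] (Fin k → ℝ) × (Fin m → ℝ) :=
  LinearMap.toContinuousLinearMap (e.symm.trans e' : _ →ₗ[ℝ] _)

theorem change_apply (v : (Fin k → ℝ) × (Fin m → ℝ)) : change e e' v = e' (e.symm v) := rfl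

/-- The parametrization `v ↦ (v, f v)` of a graph, in the other coordinates. -/
noncomputable def moved (f : Hom k m) : (Fin k → ℝ) →L[ℝ] (Fin k → ℝ) × (Fin m → ℝ) :=
  (change e e').comp ((ContinuousLinearMap.id ℝ _).prod f)

theorem moved_apply (f : Hom k m) (v : Fin k → ℝ) :
    moved e e' f v = e' (e.symm (v, f v)) := rfl

/-- The first component of `moved`. -/
noncomputable def movedFst (f : Hom k m) : (Fin k → ℝ) →L[ℝ] (Fin k → ℝ) :=
  (ContinuousLinearMap.fst ℝ _ _).comp (moved e e' f)

/-- The second component of `moved`. -/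
noncomputable def movedSnd (f : Hom k m) : Hom k m :=
  (ContinuousLinearMap.snd ℝ _ _).comp (moved e e' f)

theorem contDiff_moved : ContDiff ℝ ∞ (moved e e') := by
  have h : moved e e' = fun f => (change e e').comp
      (ContinuousLinearMap.inl ℝ _ _ + (ContinuousLinearMap.inr ℝ _ _).comp f) := by
    funext f
    ext1 v
    simp only [moved, ContinuousLinearMap.comp_apply, ContinuousLinearMap.prod_apply,
      add_apply, ContinuousLinearMap.inl_apply, ContinuousLinearMap.inr_apply,
      ContinuousLinearMap.id_apply, Prod.mk_add_mk, add_zero, zero_add]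
  rw [h]
  exact contDiff_const.clm_comp (contDiff_const.add (contDiff_const.clm_comp contDiff_id))

theorem contDiff_movedFst : ContDiff ℝ ∞ (movedFst e e') :=
  contDiff_const.clm_comp (contDiff_moved e e')

theorem contDiff_movedSnd : ContDiff ℝ ∞ (movedSnd e e') :=
  contDiff_const.clm_comp (contDiff_moved e e')

theorem graphIn_eq_iff (f g : Hom k m) :
    graphIn e f = graphIn e' g ↔ movedSnd e e' f = g.comp (movedFst e e' f) := by
  constructor
  · intro h
    ext1 v
    have := symm_mem_graphIn e f v
    rw [h, mem_graphIn] at this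
    exact this
  · intro h
    have hle : graphIn e f ≤ graphIn e' g := by
      intro x hx
      rw [mem_graphIn] at hx ⊢
      have := DFunLike.congr_fun h (e x).1
      simpa [movedSnd, movedFst, moved_apply, ← hx] using this
    have : FiniteDimensional ℝ L := e.symm.finiteDimensional
    exact Submodule.eq_of_le_of_finrank_eq hle (by rw [finrank_graphIn, finrank_graphIn])

theorem exists_graphIn_iff (f : Hom k m) :
    (∃ g, graphIn e' g = graphIn e f) ↔
      movedFst e e' f ∈ Set.range ((↑) : ((Fin k → ℝ) ≃L[ℝ] (Fin k → ℝ)) → _) := by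
  constructor
  · rintro ⟨g, hg⟩
    have hg' := (graphIn_eq_iff e e' f g).1 hg.symm
    have hinj : Function.Injective (movedFst e e' f) := by
      rw [injective_iff_map_eq_zero]
      intro v hv
      have h2 : movedSnd e e' f v = 0 := by rw [hg']; simp [hv]
      have h3 : moved e e' f v = 0 := Prod.ext hv h2
      rw [moved_apply] at h3
      have h4 : (v, f v) = 0 := by simpa using h3
      exact congrArg Prod.fst h4
    refine ⟨(LinearEquiv.ofInjectiveEndo
      (movedFst e e' f : (Fin k → ℝ) →ₗ[ℝ] (Fin k → ℝ)) hinj).toContinuousLinearEquiv, ?_⟩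
    ext1 v
    rfl
  · rintro ⟨a, ha⟩
    refine ⟨(movedSnd e e' f).comp (a.symm : _ →L[ℝ] _), ?_⟩
    symm
    rw [graphIn_eq_iff, ← ha]
    ext1 v
    simp

theorem transition_source :
    ((graphChart e).symm.trans (graphChart e')).source =
      movedFst e e' ⁻¹' Set.range ((↑) : ((Fin k → ℝ) ≃L[ℝ] (Fin k → ℝ)) → _) := by
  ext f
  rw [Set.mem_preimage, ← exists_graphIn_iff]
  simp only [PartialEquiv.trans_source, PartialEquiv.symm_source, Set.mem_inter_iff,
    Set.mem_preimage]
  exact and_iff_right (Set.mem_univ f)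

theorem isOpen_transition_source :
    IsOpen ((graphChart e).symm.trans (graphChart e')).source := by
  rw [transition_source]
  exact ContinuousLinearEquiv.isOpen.preimage (contDiff_movedFst e e').continuous

theorem contDiffOn_transition :
    ContDiffOn ℝ ∞ ((graphChart e).symm.trans (graphChart e'))
      ((graphChart e).symm.trans (graphChart e')).source := by
  have key : Set.EqOn ((graphChart e).symm.trans (graphChart e'))
      (fun f => (movedSnd e e' f).comp (ContinuousLinearMap.inverse (movedFst e e' f)))
      ((graphChart e).symm.trans (graphChart e')).source := by
    intro f hf
    rw [transition_source] at hf
    obtain ⟨a, ha⟩ := hf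
    refine graphChart_eq e' ?_
    change graphIn e' _ = graphIn e f
    symm
    rw [graphIn_eq_iff]
    simp only [← ha, ContinuousLinearMap.inverse_equiv]
    ext1 v
    simp
  refine ContDiffOn.congr ?_ key
  intro f hf
  rw [transition_source] at hf
  obtain ⟨a, ha⟩ := hf
  refine ContDiffAt.contDiffWithinAt ?_
  refine (contDiff_movedSnd e e').contDiffAt.clm_comp ?_
  have hinv : ContDiffAt ℝ ∞ (ContinuousLinearMap.inverse :
      ((Fin k → ℝ) →L[ℝ] (Fin k → ℝ)) → _) (movedFst e e' f) := by
    rw [← ha]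
    exact contDiffAt_map_inverse a
  exact hinv.comp f (contDiff_movedFst e e').contDiffAt

end Transition

variable [FiniteDimensional ℝ L]

theorem exists_graphChart (U : Gr k L) :
    ∃ e : L ≃ₗ[ℝ] (Fin k → ℝ) × (Fin (finrank ℝ L - k) → ℝ), U ∈ (graphChart e).source := by
  obtain ⟨U, hU⟩ := U
  obtain ⟨W, hW⟩ := U.exists_isCompl
  have hsum := Submodule.finrank_add_eq_of_isCompl hW
  have a : U ≃ₗ[ℝ] (Fin k → ℝ) := LinearEquiv.ofFinrankEq _ _ (by simp [hU])
  have b : W ≃ₗ[ℝ] (Fin (finrank ℝ L - k) → ℝ) := LinearEquiv.ofFinrankEq _ _ (by simp; omega)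
  refine ⟨(U.prodEquivOfIsCompl W hW).symm.trans (a.prodCongr b), 0, ?_⟩
  ext x
  simp [mem_graphIn, Submodule.prodEquivOfIsCompl_symm_apply]

/-- The standard atlas of the Grassmannian, consisting of all graph charts. -/
noncomputable def grassmannCore (k : ℕ) (L : Type*) [AddCommGroup L] [Module ℝ L]
    [FiniteDimensional ℝ L] : ChartedSpaceCore (Hom k (finrank ℝ L - k)) (Gr k L) where
  atlas := Set.range graphChart
  chartAt U := graphChart (exists_graphChart U).choose
  mem_chart_source U := (exists_graphChart U).choose_spec
  chart_mem_atlas U := ⟨_, rfl⟩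
  open_source := by
    rintro _ _ ⟨e, rfl⟩ ⟨e', rfl⟩
    exact isOpen_transition_source e e'
  continuousOn_toFun := by
    rintro _ _ ⟨e, rfl⟩ ⟨e', rfl⟩
    exact (contDiffOn_transition e e').continuousOn

noncomputable instance : TopologicalSpace (Gr k L) := (grassmannCore k L).toTopologicalSpace

noncomputable instance : ChartedSpace (Hom k (finrank ℝ L - k)) (Gr k L) :=
  (grassmannCore k L).toChartedSpace

instance : IsManifold 𝓘(ℝ, Hom k (finrank ℝ L - k)) ∞ (Gr k L) := by
  refine isManifold_of_contDiffOn _ _ _ ?_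
  intro c c' hc hc'
  change c ∈ ⋃ (e : _) (he : e ∈ (grassmannCore k L).atlas),
    {(grassmannCore k L).openPartialHomeomorph e he} at hc
  change c' ∈ ⋃ (e : _) (he : e ∈ (grassmannCore k L).atlas),
    {(grassmannCore k L).openPartialHomeomorph e he} at hc'
  simp only [Set.mem_iUnion, Set.mem_singleton_iff] at hc hc'
  obtain ⟨_, ⟨e, rfl⟩, rfl⟩ := hc
  obtain ⟨_, ⟨e', rfl⟩, rfl⟩ := hc'
  simp only [modelWithCornersSelf_coe, modelWithCornersSelf_coe_symm, Function.comp_id,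
    Function.id_comp, Set.preimage_id, Set.range_id, Set.inter_univ]
  exact contDiffOn_transition e e'

end Grassmannian

/-! ### Submanifolds and deformations -/

/-- Near the point `x`, the subset `S` of the smooth manifold `M` is an embedded submanifold of
dimension `d`: on the domain of some smooth chart around `x` it corresponds to a `d`-dimensional
linear subspace. -/
def IsSubmanifoldNear (E : Type*) {M : Type*} [NormedAddCommGroup E] [NormedSpace ℝ E]
    [TopologicalSpace M] [ChartedSpace E M] (S : Set M) (x : M) (d : ℕ) : Prop :=
  ∃ φ ∈ IsManifold.maximalAtlas 𝓘(ℝ, E) ∞ M, x ∈ φ.source ∧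
    ∃ W : Submodule ℝ E, finrank ℝ W = d ∧ ∀ y ∈ φ.source, y ∈ S ↔ φ y ∈ W

section Deformation

variable {L : Type*} [AddCommGroup L] [Module ℝ L] [FiniteDimensional ℝ L] {k : ℕ}

/-- A smooth curve in `Gr k L` through `H` at time zero, consisting of 3-Lie subalgebras. -/
structure IsDeformation (π : ThreeLieAlgebra L) (H : Gr k L) (γ : ℝ → Gr k L) : Prop where
  smooth : ContMDiff 𝓘(ℝ, ℝ) 𝓘(ℝ, Hom k (finrank ℝ L - k)) ∞ γ
  zero : γ 0 = H
  isSubalgebra : ∀ t, π.IsSubalgebra (γ t).1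

/-- The curve `γ` in `Gr k L` starts at `H` with velocity `α : H → L ⧸ H`: there is a smooth curve
`A` in `GL(L)` with `A 0 = id` and `A t H = γ t` such that `α u` is the derivative of `A t u` mod `H`
at `t = 0`. Smoothness and the derivative are tested by linear functionals. -/
def HasInitialVelocity (γ : ℝ → Gr k L) (H : Gr k L) (α : H.1 →ₗ[ℝ] (L ⧸ H.1)) : Prop :=
  ∃ A : ℝ → (L ≃ₗ[ℝ] L),
    (∀ ℓ : Dual ℝ (L →ₗ[ℝ] L), ContDiff ℝ ∞ (fun t => ℓ (A t : L →ₗ[ℝ] L))) ∧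
    A 0 = LinearEquiv.refl ℝ L ∧
    (∀ t, H.1.map (A t : L →ₗ[ℝ] L) = (γ t).1) ∧
    ∀ (u : H.1) (ℓ : Dual ℝ (L ⧸ H.1)),
      HasDerivAt (fun t => ℓ (Submodule.Quotient.mk (A t (u : L)))) (ℓ (α u)) 0

end Deformation

end ThreeLie

/-!
Fix a splitting `L = H ⊕ L ⧸ H`. Subspaces close to `H` are the graphs of linear maps
`θ : H → L ⧸ H`, that is, the images of `H` under the shears `1 + θ`. Transporting the bracket back
by the shear turns "the graph of `θ` is a subalgebra" into the equation `F(θ) = 0`, where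
`F(θ) : ⋀³ H → L ⧸ H` is the defect of `H` for the transported bracket, i.e. this bracket modulo
`H` (`ThreeLieAlgebra.defect`). The map `F` is polynomial in `θ`, vanishes at `0`, and has
derivative `d₁` there (`Splitting.hasDerivAt_defect`).

The derivative `d₁` need not be surjective, so the implicit function theorem does not apply to
`F = 0` directly. However, the fundamental identity, taken modulo `H`, is an equation
`δ_θ (F(θ)) = 0` in which `δ_θ` is linear, depends continuously on `θ`, and equals `d₂` at `θ = 0`
(`Splitting.coboundaryVal_defect`, `Splitting.coboundaryVal_eq_d₂`). If `H² = 0`, then `d₂` is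
injective on a complement of the range of `d₁`. Injectivity is an open condition
(`eventually_separating`), so `δ_θ` is injective on this complement for all small `θ`. Hence, as
soon as the component of `F(θ)` in the range of `d₁` vanishes, `F(θ)` lies in the complement and is
killed by `δ_θ`, so `F(θ) = 0`. That component is a submersion at `0`, and its zero set is
straightened to `ker d₁ = Z¹` by the local diffeomorphism `θ ↦ θ + p (F(θ) - d₁ θ)`, where `p` is
a generalized inverse of `d₁` (`exists_chart_of_unobstructed`).

The local diffeomorphism has derivative `1` at `0`. Pulling back a smooth curve in the line `ℝ α`
that stays close to `0` and has velocity `α` there gives the deformation, and the shears along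
it are the curve in `GL(L)`.

The spaces `L`, `L ⧸ H` and `⋀³ H → L ⧸ H` carry no norm, so that smoothness and derivatives of maps
into them are tested by linear functionals.
-/

namespace ThreeLie

/-! ### Functionals on finite-dimensional spaces -/

section Functionals

variable {V : Type*} [AddCommGroup V] [Module ℝ V] [FiniteDimensional ℝ V]

theorem span_eq_top_of_separating {S : Set (Dual ℝ V)} (hS : ∀ v, (∀ ℓ ∈ S, ℓ v = 0) → v = 0) :
    Submodule.span ℝ S = ⊤ := by
  have h : (Submodule.span ℝ S).dualCoannihilator = ⊥ := by
    rw [eq_bot_iff]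
    intro v hv
    rw [Submodule.mem_dualCoannihilator] at hv
    exact hS v fun ℓ hℓ => hv ℓ (Submodule.subset_span hℓ)
  rw [← Subspace.dualCoannihilator_dualAnnihilator_eq (W := Submodule.span ℝ S), h,
    Submodule.dualAnnihilator_bot]

/-- Having no common zero but `0` is an open condition on a family of functionals that depends
continuously on a parameter. The family may be infinite: finitely many members already form a
basis of the dual space. -/
theorem eventually_separating {X I : Type*} [TopologicalSpace X] (l : I → X → Dual ℝ V) {x₀ : X}
    (hl : ∀ i v, Continuous fun x => l i x v) (h₀ : ∀ v, (∀ i, l i x₀ v = 0) → v = 0) :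
    ∀ᶠ x in nhds x₀, ∀ v, (∀ i, l i x v = 0) → v = 0 := by
  obtain ⟨b, hb, hspan, hli⟩ := exists_linearIndependent ℝ (Set.range fun i => l i x₀)
  have hspan₀ : Submodule.span ℝ (Set.range fun i => l i x₀) = ⊤ :=
    span_eq_top_of_separating fun v hv => h₀ v fun i => hv (l i x₀) ⟨i, rfl⟩
  rw [hspan₀] at hspan
  choose i hi using fun j : b => hb j.2
  have : Fintype b := hli.setFinite.fintype
  let c := finBasis ℝ V
  -- The functionals are compared with their coordinate vectors in a normed space.
  let Φ : Dual ℝ V →ₗ[ℝ] (Fin (finrank ℝ V) → ℝ) := LinearMap.pi fun j => Dual.eval ℝ V (c j)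
  have hΦ : LinearMap.ker Φ = ⊥ := by
    rw [LinearMap.ker_eq_bot']
    intro ℓ hℓ
    exact c.ext fun j => congrFun hℓ j
  have hopen : IsOpen {f : b → Fin (finrank ℝ V) → ℝ | LinearIndependent ℝ f} :=
    isOpen_setOfPred_linearIndependent
  have hcont : Continuous fun (x : X) (j : b) => Φ (l (i j) x) :=
    continuous_pi fun j => continuous_pi fun r => hl (i j) (c r)
  have hmem : LinearIndependent ℝ fun j : b => Φ (l (i j) x₀) := by
    have h := hli.map' Φ hΦ
    have heq : (fun j : b => Φ (l (i j) x₀)) = Φ ∘ Subtype.val :=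
      funext fun j => congrArg Φ (hi j)
    rwa [heq]
  filter_upwards [hcont.continuousAt.eventually (hopen.mem_nhds hmem)] with x hx v hv
  have hx' : LinearIndependent ℝ fun j : b => l (i j) x := LinearIndependent.of_comp Φ hx
  have hcard : Fintype.card b = finrank ℝ (Dual ℝ V) := by
    rw [← Set.toFinset_card, ← finrank_span_set_eq_card hli, hspan, finrank_top]
  have htop := hx'.span_eq_top_of_card_eq_finrank' hcard
  rw [← forall_dual_apply_eq_zero_iff ℝ v]
  intro ℓ
  have hℓ : ℓ ∈ Submodule.span ℝ (Set.range fun j : b => l (i j) x) := htop ▸ Submodule.mem_top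
  induction hℓ using Submodule.span_induction with
  | mem ℓ hℓ => obtain ⟨j, rfl⟩ := hℓ; exact hv _
  | zero => rfl
  | add ℓ ℓ' _ _ h h' => simp [h, h']
  | smul r ℓ _ h => simp [h]

end Functionals

/-! ### Smooth maps into finite-dimensional spaces without a norm -/

section WeakSmooth

variable {E : Type*} [NormedAddCommGroup E] [NormedSpace ℝ E]
  {V W : Type*} [AddCommGroup V] [Module ℝ V] [AddCommGroup W] [Module ℝ W]

/-- Smoothness of a map into a vector space that carries no norm, tested by linear functionals.
For finite-dimensional targets this is smoothness in the usual sense. -/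
def WeakSmooth (g : E → V) : Prop := ∀ ℓ : Dual ℝ V, ContDiff ℝ ∞ fun x => ℓ (g x)

theorem weakSmooth_const (v : V) : WeakSmooth fun _ : E => v := fun _ => contDiff_const

theorem WeakSmooth.add {g h : E → V} (hg : WeakSmooth g) (hh : WeakSmooth h) :
    WeakSmooth fun x => g x + h x := fun ℓ => by
  simpa only [map_add] using (hg ℓ).add (hh ℓ)

theorem WeakSmooth.map {g : E → V} (hg : WeakSmooth g) (T : V →ₗ[ℝ] W) :
    WeakSmooth fun x => T (g x) := fun ℓ => hg (ℓ ∘ₗ T)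

theorem weakSmooth_linearMap [FiniteDimensional ℝ E] (T : E →ₗ[ℝ] V) : WeakSmooth T := fun ℓ =>
  (LinearMap.toContinuousLinearMap (ℓ ∘ₗ T)).contDiff

theorem weakSmooth_of_separating [FiniteDimensional ℝ V] {g : E → V} {S : Set (Dual ℝ V)}
    (hS : ∀ v, (∀ ℓ ∈ S, ℓ v = 0) → v = 0) (hg : ∀ ℓ ∈ S, ContDiff ℝ ∞ fun x => ℓ (g x)) :
    WeakSmooth g := by
  intro ℓ
  have hℓ : ℓ ∈ Submodule.span ℝ S := span_eq_top_of_separating hS ▸ Submodule.mem_top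
  induction hℓ using Submodule.span_induction with
  | mem ℓ hℓ => exact hg ℓ hℓ
  | zero => exact contDiff_const
  | add ℓ ℓ' _ _ h h' => exact h.add h'
  | smul r ℓ _ h => exact contDiff_const.mul h

theorem WeakSmooth.apply [FiniteDimensional ℝ W] {g : E → W →ₗ[ℝ] V} {h : E → W}
    (hg : ∀ w, WeakSmooth fun x => g x w) (hh : WeakSmooth h) :
    WeakSmooth fun x => g x (h x) := by
  intro ℓ
  let b := finBasis ℝ W
  have key : ∀ x, ℓ (g x (h x)) = ∑ i, b.coord i (h x) * ℓ (g x (b i)) := by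
    intro x
    conv_lhs => rw [← b.sum_repr (h x)]
    simp only [map_sum, map_smul, smul_eq_mul, Basis.coord_apply]
  simp only [key]
  exact ContDiff.sum fun i _ => (hh (b.coord i)).mul (hg (b i) ℓ)

theorem WeakSmooth.alternating [FiniteDimensional ℝ V] (θ : V [⋀^Fin 3]→ₗ[ℝ] W)
    {f g h : E → V} (hf : WeakSmooth f) (hg : WeakSmooth g) (hh : WeakSmooth h) :
    WeakSmooth fun x => θ ![f x, g x, h x] := by
  -- `A a b = θ ![a, b, ·]`; the variables are made to depend on `x` one after the other.
  let A (a b : V) : V →ₗ[ℝ] W :=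
    { toFun := fun c => θ ![a, b, c]
      map_add' := alt3_add3 _ _ _
      map_smul' := fun r _ => alt3_smul3 _ r _ _ _ }
  have hA : ∀ a b c, A a b c = θ ![a, b, c] := fun _ _ _ => rfl
  have h1 : ∀ b c, WeakSmooth fun x => θ ![f x, b, c] := fun b c => by
    simpa only [hA, ← alt3_cyc θ _ b c] using hf.map (A b c)
  have h2 : ∀ c, WeakSmooth fun x => θ ![f x, g x, c] := fun c => by
    have := WeakSmooth.apply (g := fun x => A c (f x)) (fun b => by
      simpa only [hA, alt3_cyc θ c _ b] using h1 b c) hg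
    simpa only [hA, alt3_cyc θ c] using this
  exact WeakSmooth.apply (g := fun x => A (f x) (g x)) h2 hh

end WeakSmooth

/-! ### Zero sets of maps with unobstructed linearization -/

section Unobstructed

variable {E : Type*} [NormedAddCommGroup E] [NormedSpace ℝ E]

theorem WeakSmooth.contDiff {E' : Type*} [NormedAddCommGroup E'] [NormedSpace ℝ E']
    [FiniteDimensional ℝ E'] {g : E → E'} (hg : WeakSmooth g) : ContDiff ℝ ∞ g := by
  rw [← (finBasis ℝ E').equivFunL.comp_contDiff_iff, contDiff_pi]
  exact fun i => hg ((finBasis ℝ E').coord i)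

/-- Every vector `v` is the velocity of a smooth curve that is defined for all times and
corresponds to a curve in the line `ℝ v` under the given chart. -/
theorem exists_curve {Ψ : OpenPartialHomeomorph E E} (h0 : 0 ∈ Ψ.source) (hΨ0 : Ψ 0 = 0)
    (hΨ : ContDiffOn ℝ ∞ Ψ.symm Ψ.target)
    (hd : HasFDerivAt Ψ.symm (ContinuousLinearMap.id ℝ E) 0) (v : E) :
    ∃ f : ℝ → E, ContDiff ℝ ∞ f ∧ f 0 = 0 ∧ HasDerivAt f v 0 ∧
      ∀ t, f t ∈ Ψ.source ∧ ∃ r : ℝ, Ψ (f t) = r • v := by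
  have h0t : (0 : E) ∈ Ψ.target := hΨ0 ▸ Ψ.map_source h0
  obtain ⟨ε, hε, hball⟩ := Metric.isOpen_iff.1 Ψ.open_target 0 h0t
  -- The curve `r⁻¹ sin (r t) • v` stays in the target of the chart if `r` is large.
  let r : ℝ := (‖v‖ + 1) / ε
  have hr : 0 < r := by positivity
  let c : ℝ → E := fun t => (Real.sin (r * t) / r) • v
  have hcs : ContDiff ℝ ∞ c :=
    ((Real.contDiff_sin.comp (contDiff_const.mul contDiff_id)).div_const r).smul contDiff_const
  have hc0 : c 0 = 0 := by simp [c]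
  have hct : ∀ t, c t ∈ Ψ.target := by
    intro t
    refine hball ?_
    rw [mem_ball_zero_iff, norm_smul, norm_div, Real.norm_eq_abs, Real.norm_eq_abs, abs_of_pos hr]
    calc |Real.sin (r * t)| / r * ‖v‖ ≤ 1 / r * ‖v‖ := by
          gcongr
          exact Real.abs_sin_le_one _
      _ < ε := by
          have : 0 < ‖v‖ + 1 := by positivity
          simp only [r, one_div, inv_div]
          rw [div_mul_eq_mul_div, div_lt_iff₀ this]
          nlinarith
  have hcd : HasDerivAt c v 0 := by
    have h1 : HasDerivAt (fun t => Real.sin (r * t) / r) 1 0 := by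
      have := (((hasDerivAt_id' (0 : ℝ)).const_mul r).sin).div_const r
      simpa [hr.ne'] using this
    simpa using h1.smul_const v
  refine ⟨fun t => Ψ.symm (c t), hΨ.comp_contDiff hcs hct, ?_, ?_,
    fun t => ⟨Ψ.map_target (hct t), _, Ψ.right_inv (hct t)⟩⟩
  · have := Ψ.left_inv h0
    rw [hΨ0] at this
    simp only [hc0, this]
  · rw [← hc0] at hd
    exact hd.comp_hasDerivAt (0 : ℝ) hcd

variable [FiniteDimensional ℝ E]

/-- A smooth map with invertible derivative at `0` is a diffeomorphism between neighbourhoods,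
which may be taken inside a prescribed neighbourhood of `0`. -/
theorem exists_openPartialHomeomorph {ψ : E → E} (hψ : ContDiff ℝ ∞ ψ)
    (hψ' : HasFDerivAt ψ (ContinuousLinearMap.id ℝ E) 0) {s : Set E} (hs : s ∈ nhds (0 : E)) :
    ∃ Ψ : OpenPartialHomeomorph E E, ⇑Ψ = ψ ∧ 0 ∈ Ψ.source ∧ Ψ.source ⊆ s ∧
      ContDiffOn ℝ ∞ Ψ.symm Ψ.target := by
  have hne : (∞ : WithTop ℕ∞) ≠ 0 := by simp
  have hψ0 : HasFDerivAt ψ ((ContinuousLinearEquiv.refl ℝ E : E ≃L[ℝ] E) : E →L[ℝ] E) 0 := hψ'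
  let Ψ₀ := hψ.contDiffAt.toOpenPartialHomeomorph ψ hψ0 hne
  -- The source is cut down to the points where the derivative is still invertible.
  let u : Set E := interior s ∩ fderiv ℝ ψ ⁻¹' Set.range ((↑) : (E ≃L[ℝ] E) → E →L[ℝ] E)
  have hu : IsOpen u :=
    isOpen_interior.inter (ContinuousLinearEquiv.isOpen.preimage (hψ.continuous_fderiv hne))
  refine ⟨Ψ₀.restrOpen u hu, rfl, ⟨?_, ?_, ?_⟩, ?_, ?_⟩
  · exact hψ.contDiffAt.mem_toOpenPartialHomeomorph_source hψ0 hne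
  · exact mem_interior_iff_mem_nhds.2 hs
  · exact ⟨ContinuousLinearEquiv.refl ℝ E, hψ0.fderiv.symm⟩
  · exact fun x hx => interior_subset hx.2.1
  · intro y hy
    obtain ⟨a, ha⟩ := ((Ψ₀.restrOpen u hu).map_target hy).2.2
    refine (OpenPartialHomeomorph.contDiffAt_symm (f₀' := a) _ hy ?_
      hψ.contDiffAt).contDiffWithinAt
    rw [ha]
    exact (hψ.differentiable hne _).hasFDerivAt

variable {C : Type*} [AddCommGroup C] [Module ℝ C] [FiniteDimensional ℝ C]

/-- Let `F` vanish at `0` with linearization `D`, and let `F` satisfy identities `l i f (F f) = 0`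
that are linear in `F f` for fixed `f`. If the linearized identities `l i 0 c = 0` hold only for
`c` in the range of `D`, then in suitable coordinates near `0` the zero set of `F` is `ker D`. -/
theorem exists_chart_of_unobstructed {I : Type*} {F : E → C} (hF : WeakSmooth F) (hF₀ : F 0 = 0)
    {D : E →ₗ[ℝ] C} (hD : ∀ (ℓ : Dual ℝ C) f, HasDerivAt (fun t : ℝ => ℓ (F (t • f))) (ℓ (D f)) 0)
    (l : I → E → Dual ℝ C) (hl : ∀ i c, Continuous fun f => l i f c)
    (hlF : ∀ i f, l i f (F f) = 0) (hex : ∀ c, (∀ i, l i 0 c = 0) → c ∈ LinearMap.range D) :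
    ∃ Ψ : OpenPartialHomeomorph E E, 0 ∈ Ψ.source ∧ Ψ 0 = 0 ∧ ContDiffOn ℝ ∞ Ψ Ψ.source ∧
      ContDiffOn ℝ ∞ Ψ.symm Ψ.target ∧ HasFDerivAt Ψ.symm (ContinuousLinearMap.id ℝ E) 0 ∧
      ∀ f ∈ Ψ.source, F f = 0 ↔ Ψ f ∈ LinearMap.ker D := by
  -- A generalized inverse `p` of `D`; then `D ∘ p` is a projection onto the range of `D`.
  obtain ⟨p₀, hp₀⟩ := D.rangeRestrict.exists_rightInverse_of_surjective D.range_rangeRestrict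
  obtain ⟨p, hp⟩ := LinearMap.exists_extend p₀
  have hDp : ∀ f, D (p (D f)) = D f := by
    intro f
    have h1 : p (D f) = p₀ ⟨D f, f, rfl⟩ := LinearMap.congr_fun hp ⟨D f, f, rfl⟩
    rw [h1]
    exact congrArg Subtype.val (LinearMap.congr_fun hp₀ ⟨D f, f, rfl⟩)
  let N : Submodule ℝ C := LinearMap.ker (D ∘ₗ p)
  -- On the complement `N` of the range of `D` the identities force `c = 0` at `f = 0`, hence
  -- also for all small `f`.
  have hsep := eventually_separating (V := N) (x₀ := (0 : E)) (fun i f => l i f ∘ₗ N.subtype)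
    (fun i c => hl i c) (by
      intro c hc
      obtain ⟨f, hf⟩ := hex c hc
      have h : D (p c) = 0 := c.2
      rw [← hf, hDp, hf] at h
      exact Subtype.ext h)
  let ψ : E → E := fun f => f + (p (F f) - p (D f))
  have hψ : ContDiff ℝ ∞ ψ := by
    refine contDiff_id.add (ContDiff.sub ?_ ?_)
    · exact (hF.map p).contDiff
    · exact (weakSmooth_linearMap (p ∘ₗ D)).contDiff
  have hψ' : HasFDerivAt ψ (ContinuousLinearMap.id ℝ E) 0 := by
    have hd := (hψ.differentiable (by simp) 0).hasFDerivAt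
    have heq : fderiv ℝ ψ 0 = ContinuousLinearMap.id ℝ E := by
      ext1 v
      rw [← sub_eq_zero, ← forall_dual_apply_eq_zero_iff ℝ]
      intro ℓ
      rw [map_sub, sub_eq_zero]
      have h1 : HasDerivAt (fun t : ℝ => t • v) v 0 := by
        simpa using (hasDerivAt_id (0 : ℝ)).smul_const v
      have h2 : HasDerivAt (fun t : ℝ => ψ (t • v)) (fderiv ℝ ψ 0 v) 0 := by
        rw [← zero_smul ℝ v] at hd
        have h := hd.comp_hasDerivAt (0 : ℝ) h1
        rw [zero_smul] at h
        exact h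
      have h3 : HasDerivAt (fun t : ℝ => ℓ (ψ (t • v))) (ℓ (fderiv ℝ ψ 0 v)) 0 :=
        (LinearMap.toContinuousLinearMap ℓ).hasFDerivAt.comp_hasDerivAt (0 : ℝ) h2
      have h4 : HasDerivAt (fun t : ℝ => t * (ℓ v - ℓ (p (D v))) + (ℓ ∘ₗ p) (F (t • v)))
          (1 * (ℓ v - ℓ (p (D v))) + (ℓ ∘ₗ p) (D v)) 0 :=
        ((hasDerivAt_id (0 : ℝ)).mul_const (ℓ v - ℓ (p (D v)))).add (hD (ℓ ∘ₗ p) v)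
      have h5 : HasDerivAt (fun t : ℝ => ℓ (ψ (t • v)))
          (1 * (ℓ v - ℓ (p (D v))) + (ℓ ∘ₗ p) (D v)) 0 := by
        refine h4.congr_of_eventuallyEq (Filter.Eventually.of_forall fun t => ?_)
        simp [ψ]
        ring
      refine (h3.unique h5).trans ?_
      simp
    rwa [heq] at hd
  obtain ⟨Ψ, hΨ, h0, hsub, hsymm⟩ := exists_openPartialHomeomorph hψ hψ' hsep
  have hΨ0 : Ψ 0 = 0 := by simp [hΨ, ψ, hF₀]
  refine ⟨Ψ, h0, hΨ0, hΨ ▸ hψ.contDiffOn, hsymm, ?_, ?_⟩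
  · have h00 : (0 : E) ∈ Ψ.target := hΨ0 ▸ Ψ.map_source h0
    have hs0 : Ψ.symm 0 = 0 := by
      have := Ψ.left_inv h0
      rwa [hΨ0] at this
    have := Ψ.hasFDerivAt_symm (f' := ContinuousLinearEquiv.refl ℝ E) h00 (by
      rw [hs0, hΨ]; exact hψ')
    exact this
  · intro f hf
    have hDψ : D (Ψ f) = D (p (F f)) := by
      rw [hΨ]
      simp [ψ, hDp]
    rw [LinearMap.mem_ker, hDψ]
    constructor
    · intro h
      simp [h]
    · intro h
      exact congrArg Subtype.val (hsub hf ⟨F f, h⟩ fun i => hlF i f)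

end Unobstructed

/-! ### Shears along a subspace and the defect of a subspace -/

section Shear

variable {L : Type*} [AddCommGroup L] [Module ℝ L]

/-- The 3-Lie bracket `T⁻¹ π(T x, T y, T z)` obtained by transport along a linear automorphism. -/
def ThreeLieAlgebra.conj (π : ThreeLieAlgebra L) (T : L ≃ₗ[ℝ] L) : ThreeLieAlgebra L where
  bracket := mkAlt3 (fun x y z => T.symm (π.bracket ![T x, T y, T z]))
    (fun _ _ _ _ => by simp [alt3_add])
    (fun _ _ _ _ => by simp [alt3_smul])
    (fun x y z => by rw [alt3_cyc])
    (fun _ _ => by simp [alt3_self])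
  fundamental x₁ x₂ x₃ x₄ x₅ := by
    simp only [mkAlt3_apply, LinearEquiv.apply_symm_apply, ← map_add]
    rw [π.fundamental]

theorem ThreeLieAlgebra.conj_bracket (π : ThreeLieAlgebra L) (T : L ≃ₗ[ℝ] L) (x y z : L) :
    (π.conj T).bracket ![x, y, z] = T.symm (π.bracket ![T x, T y, T z]) := rfl

theorem ThreeLieAlgebra.conj_refl (π : ThreeLieAlgebra L) : π.conj (LinearEquiv.refl ℝ L) = π := by
  cases π
  simp only [conj, mk.injEq]
  exact alt3_ext fun x y z => rfl

theorem ThreeLieAlgebra.conj_isSubalgebra_iff (π : ThreeLieAlgebra L) (T : L ≃ₗ[ℝ] L)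
    (H : Submodule ℝ L) :
    (π.conj T).IsSubalgebra H ↔ π.IsSubalgebra (H.map (T : L →ₗ[ℝ] L)) := by
  have hmem : ∀ y : L, y ∈ H.map (T : L →ₗ[ℝ] L) ↔ T.symm y ∈ H := fun y => by
    rw [Submodule.mem_map]
    exact ⟨fun ⟨x, hx, h⟩ => by simpa [← h] using hx, fun h => ⟨_, h, by simp⟩⟩
  constructor
  · intro h x hx y hy z hz
    rw [hmem] at *
    simpa [conj_bracket] using h _ hx _ hy _ hz
  · intro h x hx y hy z hz
    rw [conj_bracket, ← hmem]
    exact h _ ⟨x, hx, rfl⟩ _ ⟨y, hy, rfl⟩ _ ⟨z, hz, rfl⟩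

/-- The bracket of elements of `H` modulo `H`: it measures how far the subspace `H` is from
being a subalgebra. -/
def ThreeLieAlgebra.defect (π : ThreeLieAlgebra L) (H : Submodule ℝ L) :
    H [⋀^Fin 3]→ₗ[ℝ] (L ⧸ H) :=
  mkAlt3 (fun x y z => H.mkQ (π.bracket ![(x : L), (y : L), (z : L)]))
    (fun _ _ _ _ => by simp [alt3_add])
    (fun _ _ _ _ => by simp [alt3_smul])
    (fun x y z => by rw [alt3_cyc])
    (fun _ _ => by simp [alt3_self])

@[simp] theorem ThreeLieAlgebra.defect_apply (π : ThreeLieAlgebra L) (H : Submodule ℝ L)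
    (x y z : H) : π.defect H ![x, y, z] = H.mkQ (π.bracket ![(x : L), (y : L), (z : L)]) := rfl

theorem ThreeLieAlgebra.defect_eq_zero_iff (π : ThreeLieAlgebra L) (H : Submodule ℝ L) :
    π.defect H = 0 ↔ π.IsSubalgebra H := by
  constructor
  · intro h x hx y hy z hz
    have := congrArg (fun θ => θ ![⟨x, hx⟩, ⟨y, hy⟩, ⟨z, hz⟩]) h
    simpa using this
  · intro h
    refine alt3_ext fun x y z => ?_
    simpa using h _ x.2 _ y.2 _ z.2

/-- A splitting `L = H ⊕ L ⧸ H`. -/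
structure Splitting (H : Submodule ℝ L) where
  /-- the projection onto `H` -/
  proj : L →ₗ[ℝ] H
  /-- the section of the quotient map -/
  sec : (L ⧸ H) →ₗ[ℝ] L
  proj_coe : ∀ u : H, proj u = u
  mkQ_sec : ∀ v, H.mkQ (sec v) = v
  proj_sec : ∀ v, proj (sec v) = 0

theorem Splitting.nonempty (H : Submodule ℝ L) : Nonempty (Splitting H) := by
  obtain ⟨s, hs⟩ := LinearMap.exists_leftInverse_of_injective H.subtype H.ker_subtype
  have hs' : ∀ u : H, s u = u := fun u => LinearMap.congr_fun hs u
  refine ⟨⟨s, H.liftQ (LinearMap.id - H.subtype ∘ₗ s) ?_, hs', ?_, ?_⟩⟩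
  · intro x hx
    have := hs' ⟨x, hx⟩
    simp only at this
    simp [this]
  · intro v
    obtain ⟨x, rfl⟩ := H.mkQ_surjective v
    simp
  · intro v
    obtain ⟨x, rfl⟩ := H.mkQ_surjective v
    simp [hs']

namespace Splitting

variable {H : Submodule ℝ L} (S : Splitting H)

theorem proj_add_sec (x : L) : (S.proj x : L) + S.sec (H.mkQ x) = x := by
  have h : x - S.sec (H.mkQ x) ∈ H := by
    rw [← Submodule.Quotient.mk_eq_zero, ← Submodule.mkQ_apply, map_sub, S.mkQ_sec, sub_self]
  have h2 := S.proj_coe ⟨_, h⟩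
  simp only [map_sub, S.proj_sec, sub_zero] at h2
  rw [h2]
  simp

/-- The square-zero endomorphism of `L = H ⊕ L ⧸ H` given by `θ : H → L ⧸ H`. -/
def off (θ : H →ₗ[ℝ] (L ⧸ H)) : L →ₗ[ℝ] L := S.sec ∘ₗ θ ∘ₗ S.proj

theorem off_apply (θ : H →ₗ[ℝ] (L ⧸ H)) (x : L) : S.off θ x = S.sec (θ (S.proj x)) := rfl

theorem off_off (θ : H →ₗ[ℝ] (L ⧸ H)) (x : L) : S.off θ (S.off θ x) = 0 := by
  simp [off_apply, S.proj_sec]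

/-- The automorphism of `L = H ⊕ L ⧸ H` that maps `H` onto the graph of `θ`. -/
def shear (θ : H →ₗ[ℝ] (L ⧸ H)) : L ≃ₗ[ℝ] L :=
  LinearEquiv.ofLinearMap (LinearMap.id + S.off θ) (LinearMap.id - S.off θ)
    (by ext x; simp [S.off_off]) (by ext x; simp [S.off_off])

theorem shear_apply (θ : H →ₗ[ℝ] (L ⧸ H)) (x : L) : S.shear θ x = x + S.off θ x := rfl

theorem shear_symm_apply (θ : H →ₗ[ℝ] (L ⧸ H)) (x : L) :
    (S.shear θ).symm x = x - S.off θ x := rfl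

theorem shear_zero : S.shear 0 = LinearEquiv.refl ℝ L := by
  ext x
  simp [shear_apply, off_apply]

theorem mem_map_shear_iff (θ : H →ₗ[ℝ] (L ⧸ H)) (x : L) :
    x ∈ H.map (S.shear θ : L →ₗ[ℝ] L) ↔ H.mkQ x = θ (S.proj x) := by
  constructor
  · rintro ⟨u, hu, rfl⟩
    have h := S.proj_coe ⟨u, hu⟩
    simp only at h
    have hu' : H.mkQ u = 0 := by simpa using hu
    simp [shear_apply, off_apply, S.proj_sec, h, S.mkQ_sec, -Submodule.mkQ_apply, hu']
  · intro h
    refine ⟨S.proj x, (S.proj x).2, ?_⟩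
    change S.shear θ (S.proj x : L) = x
    rw [shear_apply, off_apply, S.proj_coe, ← h, S.proj_add_sec]

end Splitting

end Shear

/-! ### The linearized fundamental identity -/

section Bianchi

variable {L : Type*} [AddCommGroup L] [Module ℝ L] {H : Submodule ℝ L}

/-- The expression `d₂Val` for a bracket under which `H` need not be closed: brackets of elements
of `H` are projected to `H`, and the action on `L ⧸ H` is read off from the splitting. -/
def Splitting.coboundaryVal (S : Splitting H) (π : ThreeLieAlgebra L) (x₁ y₁ x₂ y₂ x₃ : H) :
    (H [⋀^Fin 3]→ₗ[ℝ] (L ⧸ H)) →ₗ[ℝ] (L ⧸ H) where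
  toFun θ :=
    - (θ ![S.proj (π.bracket ![(x₁ : L), y₁, x₂]), y₂, x₃]
        + θ ![x₂, S.proj (π.bracket ![(x₁ : L), y₁, y₂]), x₃])
      - θ ![x₂, y₂, S.proj (π.bracket ![(x₁ : L), y₁, x₃])]
      + θ ![x₁, y₁, S.proj (π.bracket ![(x₂ : L), y₂, x₃])]
      + H.mkQ (π.bracket ![(x₁ : L), y₁, S.sec (θ ![x₂, y₂, x₃])])
      - H.mkQ (π.bracket ![(x₂ : L), y₂, S.sec (θ ![x₁, y₁, x₃])])
      - (H.mkQ (π.bracket ![(y₂ : L), x₃, S.sec (θ ![x₁, y₁, x₂])])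
        + H.mkQ (π.bracket ![(x₃ : L), x₂, S.sec (θ ![x₁, y₁, y₂])]))
  map_add' θ η := by
    simp only [AlternatingMap.add_apply, map_add, alt3_add3]
    abel
  map_smul' c θ := by
    simp only [AlternatingMap.smul_apply, map_smul, alt3_smul3, RingHom.id_apply]
    module

/-- The analogue of the Bianchi identity: the fundamental identity for arguments in `H`, taken
modulo `H`, is a linear equation for the defect of `H`. -/
theorem Splitting.coboundaryVal_defect (S : Splitting H) (π : ThreeLieAlgebra L)
    (x₁ y₁ x₂ y₂ x₃ : H) : S.coboundaryVal π x₁ y₁ x₂ y₂ x₃ (π.defect H) = 0 := by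
  -- The inner brackets of the fundamental identity are decomposed along `L = H ⊕ L ⧸ H`.
  have h := π.fundamental (x₁ : L) y₁ x₂ y₂ x₃
  rw [← S.proj_add_sec (π.bracket ![(x₂ : L), y₂, x₃]),
    ← S.proj_add_sec (π.bracket ![(x₁ : L), y₁, x₂]),
    ← S.proj_add_sec (π.bracket ![(x₁ : L), y₁, y₂]),
    ← S.proj_add_sec (π.bracket ![(x₁ : L), y₁, x₃])] at h
  simp only [alt3_add, alt3_add2, alt3_add3] at h
  rw [alt3_cyc π.bracket (S.sec _) (y₂ : L) x₃, ← alt3_cyc π.bracket (x₃ : L) x₂ (S.sec _)] at h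
  have h' := congrArg H.mkQ h
  simp only [map_add] at h'
  simp only [coboundaryVal, LinearMap.coe_mk, AddHom.coe_mk, ThreeLieAlgebra.defect_apply]
  linear_combination (norm := module) h'

variable (S : Splitting H) (π : ThreeLieAlgebra L) (hH : π.IsSubalgebra H)

theorem Splitting.proj_bracket (x y z : H) :
    S.proj (π.bracket ![(x : L), y, z]) = (π.restrict H hH).bracket ![x, y, z] :=
  S.proj_coe ⟨_, hH _ x.2 _ y.2 _ z.2⟩

theorem Splitting.mkQ_bracket_sec (x y : H) (v : L ⧸ H) :
    H.mkQ (π.bracket ![(x : L), y, S.sec v]) = (π.quotientRep H hH).ρ ![x, y] v := by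
  conv_rhs => rw [← S.mkQ_sec v]
  rfl

theorem Splitting.coboundaryVal_eq_d₂ (x₁ y₁ x₂ y₂ x₃ : H) (θ : H [⋀^Fin 3]→ₗ[ℝ] (L ⧸ H)) :
    S.coboundaryVal π x₁ y₁ x₂ y₂ x₃ θ = (π.quotientRep H hH).d₂ θ ![x₁, y₁] ![x₂, y₂, x₃] := by
  rw [Representation.d₂_apply]
  simp only [coboundaryVal, LinearMap.coe_mk, AddHom.coe_mk, Representation.d₂Val,
    S.proj_bracket π hH, S.mkQ_bracket_sec π hH]

theorem hasDerivAt_mul_add_sq_mul (a : ℝ) {r : ℝ → ℝ} (hr : DifferentiableAt ℝ r 0) :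
    HasDerivAt (fun t => t * a + t ^ 2 * r t) a 0 := by
  have h := ((hasDerivAt_id' (0 : ℝ)).mul_const a).add
    (((hasDerivAt_id' (0 : ℝ)).fun_pow 2).mul hr.hasDerivAt)
  simp only [Nat.cast_ofNat, Nat.add_one_sub_one, pow_one, mul_zero, mul_one, zero_mul, one_mul,
    ne_eq, OfNat.ofNat_ne_zero, not_false_eq_true, zero_pow, add_zero] at h
  exact h

/-- The derivative at `0` of the defect along the graphs of `t • θ` is the coboundary of `θ`. -/
theorem Splitting.hasDerivAt_defect (θ : H →ₗ[ℝ] (L ⧸ H)) (ℓ : Dual ℝ (L ⧸ H)) (x y z : H) :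
    HasDerivAt (fun t : ℝ => ℓ ((π.conj (S.shear (t • θ))).defect H ![x, y, z]))
      (ℓ ((π.quotientRep H hH).d₁ θ ![x, y, z])) 0 := by
  let N := S.off θ
  let b (u v w : L) : L := π.bracket ![u, v, w]
  let m (u : L) : ℝ := ℓ (H.mkQ u)
  let a₁ := b (N x) y z + b x (N y) z + b x y (N z)
  let a₂ := b (N x) (N y) z + b (N x) y (N z) + b x (N y) (N z)
  let a₃ := b (N x) (N y) (N z)
  have hN : ∀ (t : ℝ) u, S.off (t • θ) u = t • N u := fun t u => by
    simp [N, Splitting.off_apply]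
  have h0 : m (b x y z) = 0 := by
    have : H.mkQ (b x y z) = 0 := by simpa using hH _ x.2 _ y.2 _ z.2
    simp only [m, this, map_zero]
  have h1 : ℓ ((π.quotientRep H hH).d₁ θ ![x, y, z]) = m a₁ - m (N (b x y z)) := by
    rw [Representation.d₁_apply]
    simp only [m, a₁, b, N, S.off_apply, S.proj_bracket π hH, map_add, S.mkQ_sec, S.proj_coe,
      map_neg, ← S.mkQ_bracket_sec π hH]
    rw [alt3_cyc π.bracket (S.sec _) (y : L) z, ← alt3_cyc π.bracket (z : L) x (S.sec _)]
    ring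
  -- The defect is a polynomial of degree four in `t`.
  have key : ∀ t : ℝ, ℓ ((π.conj (S.shear (t • θ))).defect H ![x, y, z]) =
      t * (m a₁ - m (N (b x y z)))
        + t ^ 2 * ((m a₂ - m (N a₁)) + t * (m a₃ - m (N a₂)) - t ^ 2 * m (N a₃)) := by
    intro t
    rw [ThreeLieAlgebra.defect_apply, ThreeLieAlgebra.conj_bracket]
    simp only [S.shear_apply, S.shear_symm_apply, hN, alt3_add, alt3_add2, alt3_add3, alt3_smul,
      alt3_smul2, alt3_smul3, map_add, map_sub, map_smul, smul_eq_mul, smul_add]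
    have h0' : ℓ (H.mkQ (π.bracket ![(x : L), y, z])) = 0 := h0
    simp only [m, a₁, a₂, a₃, b, map_add, h0']
    ring
  rw [h1, funext key]
  exact hasDerivAt_mul_add_sq_mul _ (r := fun t => (m a₂ - m (N a₁)) + t * (m a₃ - m (N a₂))
    - t ^ 2 * m (N a₃)) (by fun_prop)

end Bianchi

/-! ### Smooth dependence on the graph -/

section Smooth

variable {E : Type*} [NormedAddCommGroup E] [NormedSpace ℝ E] [FiniteDimensional ℝ E]
  {L : Type*} [AddCommGroup L] [Module ℝ L] {H : Submodule ℝ L}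
  (S : Splitting H) (π : ThreeLieAlgebra L) (j : E →ₗ[ℝ] (H →ₗ[ℝ] (L ⧸ H)))

theorem Splitting.weakSmooth_off : WeakSmooth fun f => S.off (j f) :=
  weakSmooth_linearMap
    ({ toFun := fun f => S.off (j f)
       map_add' := fun f g => by ext; simp [Splitting.off_apply]
       map_smul' := fun c f => by ext; simp [Splitting.off_apply] } : E →ₗ[ℝ] (L →ₗ[ℝ] L))

theorem Splitting.contDiff_shear {f : ℝ → E} (hf : ContDiff ℝ ∞ f) (ℓ : Dual ℝ (L →ₗ[ℝ] L)) :
    ContDiff ℝ ∞ fun t => ℓ (S.shear (j (f t)) : L →ₗ[ℝ] L) := by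
  have h : ∀ t, (S.shear (j (f t)) : L →ₗ[ℝ] L) = LinearMap.id + S.off (j (f t)) := fun _ => rfl
  simp only [h]
  exact ((weakSmooth_const _).add (S.weakSmooth_off j) ℓ).comp hf

theorem Splitting.hasDerivAt_shear {f : ℝ → E} {v : E} (hf : HasDerivAt f v 0) (u : H)
    (ℓ : Dual ℝ (L ⧸ H)) :
    HasDerivAt (fun t => ℓ (Submodule.Quotient.mk (S.shear (j (f t)) (u : L)))) (ℓ (j v u)) 0 := by
  have h : ∀ t, ℓ (Submodule.Quotient.mk (S.shear (j (f t)) (u : L))) = ℓ (j (f t) u) := by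
    intro t
    rw [S.shear_apply, S.off_apply, S.proj_coe, ← Submodule.mkQ_apply, map_add, S.mkQ_sec,
      Submodule.mkQ_apply, (Submodule.Quotient.mk_eq_zero H).2 u.2, zero_add]
  simp only [h]
  exact (LinearMap.toContinuousLinearMap
    (ℓ ∘ₗ LinearMap.applyₗ u ∘ₗ j)).hasFDerivAt.comp_hasDerivAt (0 : ℝ) hf

variable [FiniteDimensional ℝ L]

instance {V W : Type*} [AddCommGroup V] [Module ℝ V] [FiniteDimensional ℝ V] [AddCommGroup W]
    [Module ℝ W] [FiniteDimensional ℝ W] : FiniteDimensional ℝ (V [⋀^Fin 3]→ₗ[ℝ] W) :=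
  Module.Finite.of_injective
    ({ toFun := fun θ => θ.toMultilinearMap
       map_add' := fun _ _ => rfl
       map_smul' := fun _ _ => rfl } :
      (V [⋀^Fin 3]→ₗ[ℝ] W) →ₗ[ℝ] MultilinearMap ℝ (fun _ : Fin 3 => V) W)
    AlternatingMap.coe_multilinearMap_injective

/-- Evaluation of an alternating map at a triple, followed by a functional. -/
def evalDual {V W : Type*} [AddCommGroup V] [Module ℝ V] [AddCommGroup W] [Module ℝ W]
    (x y z : V) (ℓ : Dual ℝ W) : Dual ℝ (V [⋀^Fin 3]→ₗ[ℝ] W) where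
  toFun θ := ℓ (θ ![x, y, z])
  map_add' _ _ := by simp
  map_smul' _ _ := by simp

theorem evalDual_separating {V W : Type*} [AddCommGroup V] [Module ℝ V] [AddCommGroup W]
    [Module ℝ W] (θ : V [⋀^Fin 3]→ₗ[ℝ] W)
    (h : ∀ ℓ ∈ {ℓ' | ∃ x y z ℓ, ℓ' = evalDual x y z ℓ}, ℓ θ = 0) : θ = 0 :=
  alt3_ext fun x y z => (forall_dual_apply_eq_zero_iff ℝ _).1 fun ℓ => h _ ⟨x, y, z, ℓ, rfl⟩

theorem Splitting.weakSmooth_bracket (x y z : L) :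
    WeakSmooth fun f => (π.conj (S.shear (j f))).bracket ![x, y, z] := by
  have hoff : ∀ u, WeakSmooth fun f => S.off (j f) u := fun u =>
    (S.weakSmooth_off j).map (LinearMap.applyₗ u)
  have hT : ∀ u, WeakSmooth fun f => S.shear (j f) u := fun u =>
    (weakSmooth_const u).add (hoff u)
  have hb := WeakSmooth.alternating π.bracket (hT x) (hT y) (hT z)
  refine WeakSmooth.apply (g := fun f => ((S.shear (j f)).symm : L →ₗ[ℝ] L)) (fun u => ?_) hb
  have := (weakSmooth_const u).add ((hoff u).map (-LinearMap.id))
  simpa [S.shear_symm_apply, sub_eq_add_neg] using this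

theorem Splitting.weakSmooth_defect :
    WeakSmooth fun f => (π.conj (S.shear (j f))).defect H := by
  refine weakSmooth_of_separating evalDual_separating ?_
  rintro _ ⟨x, y, z, ℓ, rfl⟩
  exact (S.weakSmooth_bracket π j x y z).map H.mkQ ℓ

theorem Splitting.continuous_coboundaryVal (x₁ y₁ x₂ y₂ x₃ : H) (ℓ : Dual ℝ (L ⧸ H))
    (θ : H [⋀^Fin 3]→ₗ[ℝ] (L ⧸ H)) :
    Continuous fun f => ℓ (S.coboundaryVal (π.conj (S.shear (j f))) x₁ y₁ x₂ y₂ x₃ θ) := by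
  have hb := S.weakSmooth_bracket π j
  have hp := fun x y z => (hb x y z).map S.proj
  have hq := fun x y z => ((hb x y z).map H.mkQ ℓ).continuous
  have hc := fun u : H => weakSmooth_const (E := E) u
  have h1 := fun x y z u v => ((hp x y z).alternating θ (hc u) (hc v) ℓ).continuous
  have h2 := fun x y z u v => (WeakSmooth.alternating θ (hc u) (hp x y z) (hc v) ℓ).continuous
  have h3 := fun x y z u v => (WeakSmooth.alternating θ (hc u) (hc v) (hp x y z) ℓ).continuous
  simp only [coboundaryVal, LinearMap.coe_mk, AddHom.coe_mk, map_add, map_sub, map_neg]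
  exact ((((((h1 _ _ _ _ _).add (h2 _ _ _ _ _)).neg.sub (h3 _ _ _ _ _)).add
    (h3 _ _ _ _ _)).add (hq _ _ _)).sub (hq _ _ _)).sub ((hq _ _ _).add (hq _ _ _))

end Smooth

/-! ### Charts of the Grassmannian -/

section Charts

theorem trans_mem_maximalAtlas {E M : Type*} [NormedAddCommGroup E] [NormedSpace ℝ E]
    [TopologicalSpace M] [ChartedSpace E M] [IsManifold 𝓘(ℝ, E) ∞ M]
    {c : OpenPartialHomeomorph M E} (hc : c ∈ IsManifold.maximalAtlas 𝓘(ℝ, E) ∞ M)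
    {Ψ : OpenPartialHomeomorph E E} (h : ContDiffOn ℝ ∞ Ψ Ψ.source)
    (h' : ContDiffOn ℝ ∞ Ψ.symm Ψ.target) :
    c.trans Ψ ∈ IsManifold.maximalAtlas 𝓘(ℝ, E) ∞ M := by
  have hΨ : Ψ ∈ contDiffGroupoid ∞ 𝓘(ℝ, E) := by
    rw [contDiffGroupoid, mem_groupoid_of_pregroupoid]
    simpa [contDiffPregroupoid] using ⟨h, h'⟩
  have hΨ' := (contDiffGroupoid ∞ 𝓘(ℝ, E)).symm hΨ
  rw [IsManifold.maximalAtlas, mem_maximalAtlas_iff]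
  intro e he
  rw [IsManifold.maximalAtlas, mem_maximalAtlas_iff] at hc
  obtain ⟨h1, h2⟩ := hc e he
  constructor
  · rw [OpenPartialHomeomorph.trans_symm_eq_symm_trans_symm, OpenPartialHomeomorph.trans_assoc]
    exact (contDiffGroupoid ∞ 𝓘(ℝ, E)).trans hΨ' h1
  · rw [← OpenPartialHomeomorph.trans_assoc]
    exact (contDiffGroupoid ∞ 𝓘(ℝ, E)).trans h2 hΨ

variable {L : Type*} [AddCommGroup L] [Module ℝ L] [FiniteDimensional ℝ L] {k : ℕ}

/-- A graph chart as an open partial homeomorphism. -/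
noncomputable def graphHomeo (e : L ≃ₗ[ℝ] (Fin k → ℝ) × (Fin (finrank ℝ L - k) → ℝ)) :
    OpenPartialHomeomorph (Gr k L) (Hom k (finrank ℝ L - k)) :=
  (grassmannCore k L).openPartialHomeomorph (graphChart e) ⟨e, rfl⟩

theorem graphHomeo_mem_maximalAtlas (e : L ≃ₗ[ℝ] (Fin k → ℝ) × (Fin (finrank ℝ L - k) → ℝ)) :
    graphHomeo e ∈ IsManifold.maximalAtlas 𝓘(ℝ, Hom k (finrank ℝ L - k)) ∞ (Gr k L) := by
  refine StructureGroupoid.subset_maximalAtlas _ ?_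
  change graphHomeo e ∈ ⋃ (e : _) (he : e ∈ (grassmannCore k L).atlas),
    {(grassmannCore k L).openPartialHomeomorph e he}
  simp only [Set.mem_iUnion, Set.mem_singleton_iff]
  exact ⟨_, ⟨e, rfl⟩, rfl⟩

theorem coe_graphHomeo_symm (e : L ≃ₗ[ℝ] (Fin k → ℝ) × (Fin (finrank ℝ L - k) → ℝ))
    (f : Hom k (finrank ℝ L - k)) : ((graphHomeo e).symm f).1 = graphIn e f := rfl

theorem graphHomeo_target (e : L ≃ₗ[ℝ] (Fin k → ℝ) × (Fin (finrank ℝ L - k) → ℝ)) :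
    (graphHomeo e).target = Set.univ := rfl

/-- Coordinates adapted to a splitting `L = H ⊕ L ⧸ H`: in suitable linear coordinates on `L` and
under a suitable isomorphism `Hom(ℝᵏ, ℝᵐ) ≃ Hom(H, L ⧸ H)`, graphs are images of `H` under
shears. -/
theorem Splitting.exists_coordinates (H : Gr k L) (S : Splitting H.1) :
    ∃ (e : L ≃ₗ[ℝ] (Fin k → ℝ) × (Fin (finrank ℝ L - k) → ℝ))
      (j : Hom k (finrank ℝ L - k) ≃ₗ[ℝ] (H.1 →ₗ[ℝ] (L ⧸ H.1))),
      ∀ f, graphIn e f = H.1.map (S.shear (j f) : L →ₗ[ℝ] L) := by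
  have hd := H.1.finrank_quotient_add_finrank
  have hk : finrank ℝ H.1 = k := H.2
  let a : H.1 ≃ₗ[ℝ] (Fin k → ℝ) := LinearEquiv.ofFinrankEq _ _ (by simp [hk])
  let b : (L ⧸ H.1) ≃ₗ[ℝ] (Fin (finrank ℝ L - k) → ℝ) :=
    LinearEquiv.ofFinrankEq _ _ (by simp; omega)
  let e₀ : L ≃ₗ[ℝ] H.1 × (L ⧸ H.1) := LinearEquiv.ofLinearMap (S.proj.prod H.1.mkQ)
    (H.1.subtype.coprod S.sec)
    (by
      refine LinearMap.ext fun x => Prod.ext ?_ ?_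
      · simp [S.proj_coe, S.proj_sec]
      · have := S.mkQ_sec x.2
        simp at this
        simp [this])
    (by ext x; exact S.proj_add_sec x)
  refine ⟨e₀.trans (a.prodCongr b),
    LinearMap.toContinuousLinearMap.symm.trans (a.symm.arrowCongr b.symm), fun f => ?_⟩
  ext x
  rw [mem_graphIn, S.mem_map_shear_iff]
  change b (H.1.mkQ x) = f (a (S.proj x)) ↔ H.1.mkQ x = b.symm (f (a (S.proj x)))
  rw [LinearEquiv.eq_symm_apply]

end Charts

/-! ### The space of subalgebras near an unobstructed subalgebra -/

section Unobstructed

variable {L : Type*} [AddCommGroup L] [Module ℝ L]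

theorem Representation.mem_B₂_of_d₂_eq_zero {π : ThreeLieAlgebra L} {V : Type*} [AddCommGroup V]
    [Module ℝ V] (R : Representation π V) (hR : Subsingleton R.H₂) {θ : L [⋀^Fin 3]→ₗ[ℝ] V}
    (hθ : R.d₂ θ = 0) : θ ∈ R.B₂ := by
  have h : (Submodule.Quotient.mk ⟨θ, hθ⟩ : R.H₂) = 0 := Subsingleton.elim _ _
  exact (Submodule.Quotient.mk_eq_zero (R.B₂.submoduleOf R.Z₂)).1 h

variable [FiniteDimensional ℝ L]

/-- Among the graphs near a subalgebra `H` with `H² = 0`, the subalgebras form, in suitable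
coordinates, the space of 1-cocycles. -/
theorem exists_chart_subalgebras (π : ThreeLieAlgebra L) {H : Submodule ℝ L}
    (hH : π.IsSubalgebra H) (hH₂ : Subsingleton (π.quotientRep H hH).H₂) (S : Splitting H)
    {E : Type*} [NormedAddCommGroup E] [NormedSpace ℝ E] [FiniteDimensional ℝ E]
    (j : E →ₗ[ℝ] (H →ₗ[ℝ] (L ⧸ H))) (hj : Function.Surjective j) :
    ∃ Ψ : OpenPartialHomeomorph E E, 0 ∈ Ψ.source ∧ Ψ 0 = 0 ∧ ContDiffOn ℝ ∞ Ψ Ψ.source ∧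
      ContDiffOn ℝ ∞ Ψ.symm Ψ.target ∧ HasFDerivAt Ψ.symm (ContinuousLinearMap.id ℝ E) 0 ∧
      ∀ f ∈ Ψ.source, π.IsSubalgebra (H.map (S.shear (j f) : L →ₗ[ℝ] L)) ↔
        j (Ψ f) ∈ (π.quotientRep H hH).Z₁ := by
  let R := π.quotientRep H hH
  have hconj : π.conj (S.shear (j 0)) = π := by
    rw [map_zero, S.shear_zero, π.conj_refl]
  have hD : ∀ (ℓ : Dual ℝ (H [⋀^Fin 3]→ₗ[ℝ] (L ⧸ H))) f,
      HasDerivAt (fun t : ℝ => ℓ ((π.conj (S.shear (j (t • f)))).defect H))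
        (ℓ ((R.d₁ ∘ₗ j) f)) 0 := by
    intro ℓ f
    have hℓ : ℓ ∈ Submodule.span ℝ {ℓ' | ∃ x y z ℓ, ℓ' = evalDual (V := H) (W := L ⧸ H) x y z ℓ} := by
      rw [span_eq_top_of_separating evalDual_separating]
      exact Submodule.mem_top
    induction hℓ using Submodule.span_induction with
    | mem ℓ hℓ =>
      obtain ⟨x, y, z, ℓ, rfl⟩ := hℓ
      simp only [map_smul]
      exact S.hasDerivAt_defect π hH (j f) ℓ x y z
    | zero => exact hasDerivAt_const (0 : ℝ) (0 : ℝ)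
    | add ℓ ℓ' _ _ h h' => exact h.add h'
    | smul r ℓ _ h => exact h.const_mul r
  obtain ⟨Ψ, h1, h2, h3, h4, h5, h6⟩ := exists_chart_of_unobstructed
    (I := (Fin 5 → H) × Dual ℝ (L ⧸ H)) (S.weakSmooth_defect π j)
    (by rw [hconj, ThreeLieAlgebra.defect_eq_zero_iff]; exact hH) hD
    (fun i f => i.2 ∘ₗ S.coboundaryVal (π.conj (S.shear (j f)))
      (i.1 0) (i.1 1) (i.1 2) (i.1 3) (i.1 4))
    (fun i c => S.continuous_coboundaryVal π j _ _ _ _ _ i.2 c)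
    (fun i f => by simp [S.coboundaryVal_defect])
    (fun c hc => by
      have hZ : R.d₂ c = 0 := by
        refine alt2_ext fun x₁ y₁ => alt3_ext fun x₂ y₂ x₃ => ?_
        rw [← S.coboundaryVal_eq_d₂ π hH]
        refine (forall_dual_apply_eq_zero_iff ℝ _).1 fun ℓ => ?_
        have := hc (![x₁, y₁, x₂, y₂, x₃], ℓ)
        rw [hconj] at this
        exact this
      obtain ⟨θ, hθ⟩ := R.mem_B₂_of_d₂_eq_zero hH₂ hZ
      obtain ⟨f, rfl⟩ := hj θ
      exact ⟨f, hθ⟩)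
  refine ⟨Ψ, h1, h2, h3, h4, h5, fun f hf => ?_⟩
  rw [← ThreeLieAlgebra.conj_isSubalgebra_iff, ← ThreeLieAlgebra.defect_eq_zero_iff, h6 f hf]
  rfl

end Unobstructed

end ThreeLie

open ThreeLie in
theorem mainTheorem4 {L : Type*} [AddCommGroup L] [Module ℝ L] [FiniteDimensional ℝ L]
    (π : ThreeLie.ThreeLieAlgebra L) {k : ℕ} (H : ThreeLie.Gr k L) (hH : π.IsSubalgebra H.1)
    (hH₂ : Subsingleton (π.quotientRep H.1 hH).H₂) :
    ThreeLie.IsSubmanifoldNear (ThreeLie.Hom k (Module.finrank ℝ L - k))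
        {U : ThreeLie.Gr k L | π.IsSubalgebra U.1} H
        (Module.finrank ℝ (π.quotientRep H.1 hH).Z₁) ∧
      ∀ α ∈ (π.quotientRep H.1 hH).Z₁, ∃ γ : ℝ → ThreeLie.Gr k L,
        ThreeLie.IsDeformation π H γ ∧ ThreeLie.HasInitialVelocity γ H α := by
  obtain ⟨S⟩ := Splitting.nonempty H.1
  obtain ⟨e, j, hgraph⟩ := S.exists_coordinates H
  let J : Hom k (finrank ℝ L - k) →ₗ[ℝ] (H.1 →ₗ[ℝ] (L ⧸ H.1)) := j
  obtain ⟨Ψ, h0, hΨ0, hΨ, hΨs, hd, hsub⟩ :=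
    exists_chart_subalgebras π hH hH₂ S J j.surjective
  have hc := graphHomeo_mem_maximalAtlas e
  have hshear : S.shear (j 0) = LinearEquiv.refl ℝ L := by
    rw [map_zero, S.shear_zero]
  have hHsymm : (graphHomeo e).symm 0 = H := by
    refine Subtype.ext ?_
    rw [coe_graphHomeo_symm, hgraph, hshear]
    exact Submodule.map_id _
  have htarget : ∀ f, f ∈ (graphHomeo e).target := fun f => Set.mem_univ f
  have hHsource : H ∈ (graphHomeo e).source := hHsymm ▸ (graphHomeo e).map_target (htarget 0)
  have hH0 : graphHomeo e H = 0 := by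
    conv_lhs => rw [← hHsymm]
    exact (graphHomeo e).right_inv (htarget 0)
  constructor
  · refine ⟨(graphHomeo e).trans Ψ, trans_mem_maximalAtlas hc hΨ hΨs, ?_,
      (π.quotientRep H.1 hH).Z₁.comap J, ?_, ?_⟩
    · rw [OpenPartialHomeomorph.trans_source]
      refine ⟨hHsource, ?_⟩
      rw [Set.mem_preimage, hH0]
      exact h0
    · exact (j.ofSubmodule' (π.quotientRep H.1 hH).Z₁).finrank_eq
    · intro U hU
      rw [OpenPartialHomeomorph.trans_source] at hU
      have hU' : U.1 = graphIn e (graphHomeo e U) := by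
        conv_lhs => rw [← (graphHomeo e).left_inv hU.1]
        rfl
      rw [Set.mem_ofPred_eq, hU', hgraph]
      exact hsub _ hU.2
  · intro α hα
    obtain ⟨f, hf, hf0, hfd, hft⟩ := exists_curve h0 hΨ0 hΨs hd (j.symm α)
    have hJ : J (j.symm α) = α := j.apply_symm_apply α
    refine ⟨fun t => (graphHomeo e).symm (f t), ⟨?_, ?_, ?_⟩,
      fun t => S.shear (j (f t)), S.contDiff_shear J hf, ?_, ?_, fun u ℓ => ?_⟩
    · have h := contMDiffOn_symm_of_mem_maximalAtlas hc
      rw [graphHomeo_target, contMDiffOn_univ] at h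
      exact h.comp hf.contMDiff
    · simp only [hf0, hHsymm]
    · intro t
      obtain ⟨hs, r, hr⟩ := hft t
      rw [coe_graphHomeo_symm, hgraph]
      refine (hsub (f t) hs).2 ?_
      rw [hr, map_smul]
      exact Submodule.smul_mem _ _ (hJ.symm ▸ hα)
    · simp only [hf0, hshear]
    · intro t
      rw [coe_graphHomeo_symm, hgraph]
    · have h := S.hasDerivAt_shear J hfd u ℓ
      rw [hJ] at h
      exact h
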